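/- \textbf{Setting.} Let $T=(V,E)$ be a tree with $N$ vertices (parties) and a fixed root $v_1\in V$. Let $\mathcal H=\mathbb C^D$ with $D\ge 1$, let $\tilde{\mathcal H}^{v}$ ($v\in V$) be finite-dimensional Hilbert spaces, let $U:\mathcal H\to\bigotimes_{v\in V}\tilde{\mathcal H}^{v}$ be an isometry, and let $M_e\ge 1$ ($e\in E$) be integers. Write $|\Phi_M^+\rangle=\frac1{\sqrt M}\sum_{l=0}^{M-1}|l\rangle\otimes|l\rangle$. \emph{Concentrating quantum information over $T$ for $U$ is achievable} (with $(M_e)_{e\in E}$) if there is a finite-round LOCC map $\mathcal C$ of the parties $V$, where for each edge $e$ the two end vertices share $|\Phi_{M_e}^+\rangle$, with $$\mathcal C\Big(U\rho U^\dagger\otimes\bigotimes_{e\in E}|\Phi_{M_e}^+\rangle\langle\Phi_{M_e}^+|\Big)=\rho\quad\text{at }v_1,\text{ for all density operators }\rho\text{ on }\mathcal H .$$ An \emph{ascending labeling} is a numbering $v_1,\dots,v_N$ of $V$, starting with the root, in which every vertex on the path from $v_1$ to $v_k$ has a label at most $k$; $p(v_k)$ denotes the parent of $v_k$. \textbf{Koashi--Imoto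 decompositions and merging.} A Koashi--Imoto decomposition of a unit vector $\psi\in\mathcal H^{R}\otimes\mathcal H^{A}\otimes\mathcal H^{B}$ consists of decompositions $\bigoplus_{j}\mathcal H^{a_j^L}\otimes\mathcal H^{a_j^R}$ and $\bigoplus_{j}\mathcal H^{b_j^L}\otimes\mathcal H^{b_j^R}$ of $\mathcal H^A$ and $\mathcal H^B$ (or of subspaces of them that contain the supports of the reduced states of $\psi$), a probability distribution $p$, and unit vectors $\omega_j\in\mathcal H^{a_j^L}\otimes\mathcal H^{b_j^L}$, $\phi_j\in\mathcal H^{R}\otimes\mathcal H^{a_j^R}\otimes\mathcal H^{b_j^R}$ with $\psi=\bigoplus_j\sqrt{p(j)}\,\omega_j\otimes\phi_j$. Let $\lambda_0^{a_j^L}$ be the largest eigenvalue of the reduced state of $\omega_j$ on $\mathcal H^{a_j^L}$. A measurement $\{|m\rangle\}$ of $A$, with $\sum_m|m\rangle\langle m|=1$ on $\mathcal H^A$ and $A$'s half of $\Phi_K^+$, achieves exact state merging of $\psi$ with $\Phi_K^+$ if for each outcome $m$ an isometry of $B$ takes $(1\otimes\langle m|)(\psi\otimes\Phi_K^+)$ to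 $\psi\otimes\chi_m$, where $A$'s part of $\psi$ is now at $B$ and $\chi_m$ is some vector of an auxiliary system of $B$. \textbf{Intermediate states.} Given an ascending labeling, put $|\Phi^N\rangle=\frac1{\sqrt D}\sum_{l}|l\rangle\otimes U|l\rangle\in\mathcal H^R\otimes\bigotimes_v\tilde{\mathcal H}^{v}$ with $\mathcal H^R=\mathbb C^D$. For $k=N,N-1,\dots,2$, given the state $\Phi^{k}_{\boldsymbol m_k}$ of $R,v_1,\dots,v_k$, where $\boldsymbol m_k$ are the outcomes of $v_N,\dots,v_{k+1}$, take $R$, $v_k$ and $v_1\cdots v_{k-1}$ in the roles of $R$, $A$, $B$ and $e=\{p(v_k),v_k\}$. Fix a Koashi--Imoto decomposition of $\Phi^k_{\boldsymbol m_k}$, with blocks $\mathcal H_{\boldsymbol m_k}^{(v_k)_j^L}\otimes\mathcal H_{\boldsymbol m_k}^{(v_k)_j^R}$ on the side of $v_k$ and eigenvalues $\lambda_{\boldsymbol m_k,0}^{(v_k)_j^L}$. Let $v_k$ perform a measurement $\{|m^{v_k}\rangle\}$ that achieves exact state merging of $\Phi^k_{\boldsymbol m_k}$ with $\Phi_{M_e}^+$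 (if one exists; otherwise any family of vectors), and for each outcome of non-zero probability let $\Phi^{k-1}_{\boldsymbol m_{k-1}}$ be the normalisation of $(1\otimes\langle m^{v_k}|)(\Phi^k_{\boldsymbol m_k}\otimes\Phi_{M_e}^+)$, with the remaining half of $\Phi_{M_e}^+$ counted as part of the system of $p(v_k)$. \textbf{Theorem.} For every tree $T$ and isometry $U$, concentrating quantum information over $T$ for $U$ is achievable if there is an ascending labeling of the vertices, with some choice of the decompositions and measurements above, such that for each edge $e=\{p(v_k),v_k\}\in E$ $$\log_2 M_e\;\ge\;\max_{\boldsymbol m_k,\,j}\ \log_2\Big\lceil\lambda_{\boldsymbol m_k,0}^{(v_k)_j^L}\,\dim\mathcal H_{\boldsymbol m_k}^{(v_k)_j^R}\Big\rceil .$$ -/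

import Mathlib

open scoped Matrix ComplexOrder

noncomputable section

/-! ### LOCC maps

A system of the parties `v : V` has local spaces `ℂ^(ι v)` with `ι v` finite; an operator on the
joint system is a matrix indexed by `∀ v, ι v`. -/

/-- The tensor product `⨂ v, A v` of local operators `A v : ℂ^(ι v) → ℂ^(κ v)`. -/
def localOp {V : Type} [Fintype V] {ι κ : V → Type} (A : ∀ v, Matrix (κ v) (ι v) ℂ) :
    Matrix (∀ v, κ v) (∀ v, ι v) ℂ :=
  fun y x => ∏ v, A v (y v) (x v)

/-- Deterministic LOCC maps with finitely many rounds.  In each round one party `v` performs a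
measurement with Kraus operators `A o v` (`o` the outcome, `∑ o, (A o v)ᴴ * A o v = 1`) and
announces `o` to everybody; every other party `w` then applies a local isometry `A o w` depending
on `o` (for instance the identity), and the protocol goes on with an LOCC map depending on `o`.
All local dimensions may change and may depend on the outcomes.  A local channel or instrument of
a party is a measurement round whose outcome (or a part of it) is not used afterwards. -/
inductive IsLOCC {V : Type} [Fintype V] [DecidableEq V] {κ : V → Type} :
    {ι : V → Type} →
    (Matrix (∀ v, ι v) (∀ v, ι v) ℂ → Matrix (∀ v, κ v) (∀ v, κ v) ℂ) → Prop
  | id : IsLOCC (ι := κ) (fun ρ => ρ)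
  | round {ι : V → Type} [∀ v, Fintype (ι v)] [∀ v, DecidableEq (ι v)]
      (v : V) {O : Type} [Fintype O] {ι' : O → V → Type} [∀ o w, Fintype (ι' o w)]
      (A : ∀ o w, Matrix (ι' o w) (ι w) ℂ)
      (hv : ∑ o, (A o v)ᴴ * A o v = 1)
      (hw : ∀ o w, w ≠ v → (A o w)ᴴ * A o w = 1)
      (next : ∀ o, Matrix (∀ w, ι' o w) (∀ w, ι' o w) ℂ → Matrix (∀ w, κ w) (∀ w, κ w) ℂ)
      (hnext : ∀ o, IsLOCC (next o)) :
      IsLOCC (ι := ι) (fun ρ => ∑ o, next o (localOp (A o) * ρ * (localOp (A o))ᴴ))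

/-! ### Concentrating quantum information over a graph -/

/-- Amplitude `⟨i j | Φ_M⁺⟩` of the maximally entangled state `M^(-1/2) ∑ l, |l⟩ ⊗ |l⟩`. -/
def maxEnt (M : ℕ) (i j : Fin M) : ℂ :=
  if i = j then ((1 / Real.sqrt M : ℝ) : ℂ) else 0

section Task

variable {V : Type} [Fintype V] [DecidableEq V]

/-- Basis labels of everything party `v` holds at the beginning of the task: its part `ℂ^(ι v)`
of the physical system and, for each edge `e` at `v`, its half of `Φ_{M e}⁺`. -/
abbrev InitialSystem (G : SimpleGraph V) (M : Sym2 V → ℕ) (ι : V → Type) (v : V) : Type :=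
  ι v × (∀ e : G.edgeSet, v ∈ e.1 → Fin (M e.1))

/-- Basis labels of what party `v` holds at the end: the logical system `ℂ^D` if `v` is the party
`r`, and a one-dimensional system otherwise. -/
abbrev FinalSystem (r : V) (D : ℕ) (v : V) : Type := v = r → Fin D

open Classical in
/-- Amplitude of the initial resource state `⨂ e, |Φ_{M e}⁺⟩`: the product over the edges of
`1 / √(M e)` if both halves carry the same label, and of `0` otherwise. -/
def resourceAmp (G : SimpleGraph V) [DecidableRel G.Adj] (M : Sym2 V → ℕ) {ι : V → Type}
    (x : ∀ v, InitialSystem G M ι v) : ℂ :=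
  ∏ e : G.edgeSet,
    if ∀ v w, ∀ (hv : v ∈ e.1) (hw : w ∈ e.1), (x v).2 e hv = (x w).2 e hw
    then ((1 / Real.sqrt (M e.1) : ℝ) : ℂ) else 0

/-- The initial state `U ρ U† ⊗ ⨂ e, |Φ_{M e}⁺⟩⟨Φ_{M e}⁺|`. -/
def initialState (G : SimpleGraph V) [DecidableRel G.Adj] (M : Sym2 V → ℕ) {ι : V → Type}
    {D : ℕ} (U : Matrix (∀ v, ι v) (Fin D) ℂ) (ρ : Matrix (Fin D) (Fin D) ℂ) :
    Matrix (∀ v, InitialSystem G M ι v) (∀ v, InitialSystem G M ι v) ℂ :=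
  fun x y => (U * ρ * Uᴴ) (fun v => (x v).1) (fun v => (y v).1) *
    (resourceAmp G M x * star (resourceAmp G M y))

/-- The state `ρ` located at party `r`. -/
def finalState (r : V) {D : ℕ} (ρ : Matrix (Fin D) (Fin D) ℂ) :
    Matrix (∀ v, FinalSystem r D v) (∀ v, FinalSystem r D v) ℂ :=
  fun x y => ρ (x r rfl) (y r rfl)

/-- Concentrating quantum information over `G` for `U` is achievable with the initial resource
state given by `M`: a single LOCC map recovers at `r` every density operator `ρ` from `U ρ U†`,
exactly and deterministically. -/
def ConcentratingAchievable (G : SimpleGraph V) [DecidableRel G.Adj] (r : V) {ι : V → Type}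
    {D : ℕ} (U : Matrix (∀ v, ι v) (Fin D) ℂ) (M : Sym2 V → ℕ) : Prop :=
  ∃ C : Matrix (∀ v, InitialSystem G M ι v) (∀ v, InitialSystem G M ι v) ℂ →
      Matrix (∀ v, FinalSystem r D v) (∀ v, FinalSystem r D v) ℂ,
    IsLOCC C ∧ ∀ ρ : Matrix (Fin D) (Fin D) ℂ, ρ.PosSemidef → ρ.trace = 1 →
      C (initialState G M U ρ) = finalState r ρ

end Task

/-! ### Koashi–Imoto decompositions and exact state merging

A tripartite vector in `ℂ^R ⊗ ℂ^A ⊗ ℂ^B` is a function `ψ : R → A → B → ℂ`. -/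

section Merging

/-- A Koashi–Imoto decomposition of a tripartite pure state `ψ`: identifications (`embA`, `embB`)
of `⨁ j, a_j^L ⊗ a_j^R` and `⨁ j, b_j^L ⊗ b_j^R` with subspaces of `ℂ^A` and `ℂ^B` such that
`ψ = ⨁ j, √(p j) ω_j ⊗ φ_j` with `ω_j ∈ a_j^L ⊗ b_j^L` and `φ_j ∈ R ⊗ a_j^R ⊗ b_j^R`.  The
subspaces then contain the supports of the reduced states of `ψ`; they are allowed, but not
required, to be all of `ℂ^A` and `ℂ^B`. -/
structure KoashiImotoDecomposition {R A B : Type} [Fintype R] [Fintype A] [Fintype B]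
    (ψ : R → A → B → ℂ) where
  J : ℕ
  aL : Fin J → ℕ
  aR : Fin J → ℕ
  bL : Fin J → ℕ
  bR : Fin J → ℕ
  embA : Matrix A (Σ j, Fin (aL j) × Fin (aR j)) ℂ
  embB : Matrix B (Σ j, Fin (bL j) × Fin (bR j)) ℂ
  embA_isometry : embAᴴ * embA = 1
  embB_isometry : embBᴴ * embB = 1
  p : Fin J → ℝ
  p_nonneg : ∀ j, 0 ≤ p j
  p_sum : ∑ j, p j = 1
  ω : ∀ j, Matrix (Fin (aL j)) (Fin (bL j)) ℂ
  ω_unit : ∀ j, ∑ x, ∑ y, ‖ω j x y‖ ^ 2 = 1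
  φ : ∀ j, R → Fin (aR j) → Fin (bR j) → ℂ
  φ_unit : ∀ j, ∑ r, ∑ x, ∑ y, ‖φ j r x y‖ ^ 2 = 1
  decomp : ∀ r a b, ψ r a b = ∑ j, (Real.sqrt (p j) : ℂ) *
    ∑ x : Fin (aL j) × Fin (aR j), ∑ y : Fin (bL j) × Fin (bR j),
      embA a ⟨j, x⟩ * embB b ⟨j, y⟩ * (ω j x.1 y.1 * φ j r x.2 y.2)

/-- The largest eigenvalue of the reduced state `tr_{b_j^L} |ω_j⟩⟨ω_j|` (whose matrix is
`ω_j ω_jᴴ`) on `a_j^L`. -/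
def KoashiImotoDecomposition.maxEigenvalue {R A B : Type}
    [Fintype R] [Fintype A] [Fintype B] {ψ : R → A → B → ℂ}
    (δ : KoashiImotoDecomposition ψ) (j : Fin δ.J) : ℝ :=
  ⨆ i, (Matrix.isHermitian_mul_conjTranspose_self (δ.ω j)).eigenvalues i

/-- `log₂ K ≥ max_j log₂ ⌈λ₀^{a_j^L} dim a_j^R⌉`. -/
def KoashiImotoDecomposition.CostAtMost {R A B : Type}
    [Fintype R] [Fintype A] [Fintype B] {ψ : R → A → B → ℂ}
    (δ : KoashiImotoDecomposition ψ) (K : ℕ) : Prop :=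
  ∀ j, Real.logb 2 ⌈δ.maxEigenvalue j * (δ.aR j : ℝ)⌉₊ ≤ Real.logb 2 K

/-- The vector `(1^{RB} ⊗ ⟨m|^A) (ψ ⊗ Φ_K⁺)`, where `m` is a vector on `A` and `A`'s half of
`Φ_K⁺`; the result lives on `R`, `B` and `B`'s half of `Φ_K⁺`. -/
def measured {R A B : Type} [Fintype A] {K : ℕ} (ψ : R → A → B → ℂ) (m : A × Fin K → ℂ) : R → B × Fin K → ℂ :=
  fun r y => ∑ a, ∑ i, star (m (a, i)) * (ψ r a y.1 * maxEnt K i y.2)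

open Classical in
/-- The vectors `m o` (`o : Fin n` the outcomes) form a measurement `∑ o, |m o⟩⟨m o| = 1` by
which `A` achieves exact state merging of `ψ` with the help of `Φ_K⁺`: for every outcome there is
an isometry `W` of `B`, from `B` and its half of `Φ_K⁺` to `B'`, `B` and an auxiliary system, that
takes the unnormalised state after the measurement to `ψ^{R B' B} ⊗ χ`.  Orthonormal bases are
included; the other families are orthonormal bases of an extension of the space by an auxiliary
system of `A`. -/
def IsExactMerging {R A B : Type} [Fintype A] [Fintype B] {K n : ℕ}
    (ψ : R → A → B → ℂ) (m : Fin n → A × Fin K → ℂ) : Prop :=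
  (∑ o, Matrix.vecMulVec (m o) (star (m o)) = 1) ∧
  ∀ o, ∃ (d : ℕ) (W : Matrix ((A × B) × Fin d) (B × Fin K) ℂ) (χ : Fin d → ℂ),
    Wᴴ * W = 1 ∧
    ∀ r a b i, ∑ y, W ((a, b), i) y * measured ψ (m o) r y = χ i * ψ r a b

/-- `m` is a measurement by which `A` achieves exact state merging of `ψ` with `Φ_K⁺`, provided
that one exists.  (Such an `m` can be chosen for every `ψ` and `K`; whether it does merge `ψ` is
not part of this notion.) -/
def IsMergingMeasurement {R A B : Type} [Fintype A] [Fintype B] {K n : ℕ}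
    (ψ : R → A → B → ℂ) (m : Fin n → A × Fin K → ℂ) : Prop :=
  (∃ (n' : ℕ) (m' : Fin n' → A × Fin K → ℂ), IsExactMerging ψ m') → IsExactMerging ψ m

end Merging

/-! ### Rooted trees, ascending labelings and the sequence of intermediate states -/

section Tree

variable {V : Type} [Fintype V]

/-- The parent of `v` in the tree `T` with root `r`: the vertex next to `v` on the path from `v`
to `r`. -/
def parent {T : SimpleGraph V} (hT : T.IsTree) (r v : V) : V :=
  (hT.existsUnique_path v r).choose.snd

/-- Ascending labelings: the vertex `v_k` is the one with `label v_k = k - 1`; the root is `v_1`,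
and on the path from the root to `v` no label exceeds that of `v`. -/
structure AscendingLabeling (T : SimpleGraph V) (r : V) where
  label : V ≃ Fin (Fintype.card V)
  label_root : (label r : ℕ) = 0
  ascending : ∀ (v : V) (q : T.Walk r v), q.IsPath → ∀ w ∈ q.support, label w ≤ label v

/-- The parent of a non-root vertex has a smaller label. -/
theorem AscendingLabeling.parent_lt {T : SimpleGraph V} (hT : T.IsTree) {r : V}
    (L : AscendingLabeling T r) {v : V} (hv : v ≠ r) : L.label (parent hT r v) < L.label v := by
  have hq := (hT.existsUnique_path v r).choose_spec.1
  set q := (hT.existsUnique_path v r).choose with hqdef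
  have hn : ¬ q.Nil := SimpleGraph.Walk.not_nil_of_ne hv
  have hadj : T.Adj v q.snd := q.adj_snd hn
  have hle : L.label q.snd ≤ L.label v := by
    refine L.ascending v q.reverse hq.reverse _ ?_
    rw [SimpleGraph.Walk.support_reverse, List.mem_reverse]
    exact q.getVert_mem_support 1
  refine lt_of_le_of_ne hle fun h => hadj.ne ?_
  exact (L.label.injective h).symm

/-- The `(k+1)`-st vertex `v_{k+1}`. -/
def AscendingLabeling.vertex {T : SimpleGraph V} {r : V} (L : AscendingLabeling T r) (k : ℕ)
    (hk : k < Fintype.card V) : V := L.label.symm ⟨k, hk⟩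

theorem AscendingLabeling.label_vertex {T : SimpleGraph V} {r : V} (L : AscendingLabeling T r)
    (k : ℕ) (hk : k < Fintype.card V) : (L.label (L.vertex k hk) : ℕ) = k := by
  simp [AscendingLabeling.vertex]

theorem AscendingLabeling.eq_vertex {T : SimpleGraph V} {r : V} (L : AscendingLabeling T r)
    {k : ℕ} (hk : k < Fintype.card V) {w : V} (h : (L.label w : ℕ) < k + 1)
    (h' : ¬ (L.label w : ℕ) < k) : L.vertex k hk = w := by
  rw [AscendingLabeling.vertex, Equiv.symm_apply_eq]
  ext
  simp only
  omega

theorem AscendingLabeling.label_parent_vertex {T : SimpleGraph V} (hT : T.IsTree) {r : V}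
    (L : AscendingLabeling T r) (k : ℕ) (hk : k + 1 < Fintype.card V) :
    (L.label (parent hT r (L.vertex (k + 1) hk)) : ℕ) < k + 1 := by
  have hne : L.vertex (k + 1) hk ≠ r := by
    intro h
    have h1 := L.label_vertex (k + 1) hk
    rw [h, L.label_root] at h1
    omega
  have h2 := L.parent_lt hT hne
  rw [Fin.lt_def, L.label_vertex] at h2
  exact h2

variable [DecidableEq V]

/-- Basis labels of the system `v` holds when the parties `v_1, …, v_k` remain (for `v` one of
them): its part of the physical system and, for each child `c` of `v` that is no longer among
them, `v`'s half of the resource state `Φ_{M {p(c), c}}⁺`. -/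
abbrev HeldSystem {T : SimpleGraph V} (hT : T.IsTree) {r : V} (L : AscendingLabeling T r)
    (M : Sym2 V → ℕ) (ι : V → Type) (k : ℕ) (v : V) : Type :=
  ι v × (∀ c : V, parent hT r c = v → k ≤ (L.label c : ℕ) → Fin (M s(parent hT r c, c)))

/-- Basis labels of the joint system of `v_1, …, v_k` when these parties remain. -/
abbrev JointSystem {T : SimpleGraph V} (hT : T.IsTree) {r : V} (L : AscendingLabeling T r)
    (M : Sym2 V → ℕ) (ι : V → Type) (k : ℕ) : Type :=
  ∀ w : V, (L.label w : ℕ) < k → HeldSystem hT L M ι k w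

/-- Basis labels of the joint system of `v_1, …, v_k` when `v_1, …, v_{k+1}` remain. -/
abbrev RestSystem {T : SimpleGraph V} (hT : T.IsTree) {r : V} (L : AscendingLabeling T r)
    (M : Sym2 V → ℕ) (ι : V → Type) (k : ℕ) : Type :=
  ∀ w : V, (L.label w : ℕ) < k → HeldSystem hT L M ι (k + 1) w

variable {T : SimpleGraph V} (hT : T.IsTree) {r : V} (L : AscendingLabeling T r)
  (M : Sym2 V → ℕ) {ι : V → Type} {D : ℕ}

/-- A vector in `R ⊗ (v_1 ⋯ v_{k+1})` as a tripartite vector in `R ⊗ v_{k+1} ⊗ (v_1 ⋯ v_k)`. -/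
def splitLast (k : ℕ) (hk : k < Fintype.card V)
    (ψ : Fin D → JointSystem hT L M ι (k + 1) → ℂ) :
    Fin D → HeldSystem hT L M ι (k + 1) (L.vertex k hk) → RestSystem hT L M ι k → ℂ :=
  fun l a b => ψ l fun w hw =>
    if h : (L.label w : ℕ) < k then b w h else L.eq_vertex hk hw h ▸ a

/-- A vector on `R`, the systems of `v_1, …, v_{k+1}` before the merging of `v_{k+2}`, and the
parent's half of the resource state of the edge `{p(v_{k+2}), v_{k+2}}`, the latter regarded as
part of the system of `p(v_{k+2})`. -/
def absorb (k : ℕ) (hk : k + 1 < Fintype.card V)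
    (ψ : Fin D → RestSystem hT L M ι (k + 1) ×
      Fin (M s(parent hT r (L.vertex (k + 1) hk), L.vertex (k + 1) hk)) → ℂ) :
    Fin D → JointSystem hT L M ι (k + 1) → ℂ :=
  fun l x => ψ l
    (fun w hw => ((x w hw).1, fun c hc hle => (x w hw).2 c hc (Nat.le_of_succ_le hle)),
      (x _ (L.label_parent_vertex hT k hk)).2 (L.vertex (k + 1) hk) rfl
        (L.label_vertex (k + 1) hk).ge)

/-- `ψ / ‖ψ‖`. -/
def normalized {X Y : Type} [Fintype X] [Fintype Y] (ψ : X → Y → ℂ) : X → Y → ℂ :=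
  fun x y => ψ x y / (Real.sqrt (∑ x', ∑ y', ‖ψ x' y'‖ ^ 2) : ℂ)

/-- The cost bound for sequential exact state merging from the state `ψ = Φ^k` of `R` and
`v_1, …, v_k` on.  For `k ≥ 2`: for a Koashi–Imoto decomposition of `Φ^k`, with `R`, `v_k` and
`v_1 ⋯ v_{k-1}` in the roles of `R`, `A` and `B`,
`log₂ M_{{p(v_k), v_k}} ≥ max_j log₂ ⌈λ₀ dim⌉` holds; and, with `v_k` using a merging measurement
for `Φ^k`, for every outcome `m` of non-zero probability the same is true from the state
`Φ^{k-1} ∝ (1 ⊗ ⟨m|)(Φ^k ⊗ Φ_{M_{{p(v_k), v_k}}}⁺)` on. -/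
def MergingCostBound [∀ v, Fintype (ι v)] :
    (k : ℕ) → k ≤ Fintype.card V → (Fin D → JointSystem hT L M ι k → ℂ) → Prop
  | 0, _, _ => True
  | 1, _, _ => True
  | k + 2, hk, ψ =>
    (∃ δ : KoashiImotoDecomposition (splitLast hT L M (k + 1) hk ψ),
      δ.CostAtMost (M s(parent hT r (L.vertex (k + 1) hk), L.vertex (k + 1) hk))) ∧
    ∃ (n : ℕ) (m : Fin n → HeldSystem hT L M ι (k + 2) (L.vertex (k + 1) hk) ×
        Fin (M s(parent hT r (L.vertex (k + 1) hk), L.vertex (k + 1) hk)) → ℂ),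
      IsMergingMeasurement (splitLast hT L M (k + 1) hk ψ) m ∧
      ∀ o, measured (splitLast hT L M (k + 1) hk ψ) (m o) ≠ 0 →
        MergingCostBound (k + 1) (Nat.le_of_succ_le hk)
          (normalized (absorb hT L M k hk (measured (splitLast hT L M (k + 1) hk ψ) (m o))))

/-- The state `Φ^N = (1^R ⊗ U) D^(-1/2) ∑ l, |l⟩ ⊗ |l⟩` of `R` and `v_1, …, v_N`. -/
def referenceState (U : Matrix (∀ v, ι v) (Fin D) ℂ) :
    Fin D → JointSystem hT L M ι (Fintype.card V) → ℂ :=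
  fun l x => ((1 / Real.sqrt D : ℝ) : ℂ) * U (fun v => (x v (L.label v).isLt).1) l

end Tree

end

open scoped Kronecker

noncomputable section

/-! ### Extending a partial isometry -/

/-! A measurement outcome of `A` lets `B` rebuild `ψ` as soon as the reference `R` notices nothing:
the components along `R` of the remaining vector must have a Gram matrix proportional to that of
`ψ`. Families with equal Gram matrices differ by an isometry (`exists_merging_isometry`), and
conversely isometries preserve Gram matrices (`IsExactMerging.exists_gram_measured`).

In block `j` of a Koashi–Imoto decomposition a measurement vector acts on `φ_j` through an operator
`G_j` on `a_j^R`, and the Gram matrix is merely rescaled if `G_jᴴ G_j` is the same multiple of the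
identity for all `j`. Suitable vectors (`exists_block_ensemble`) come from random injections of the
basis of `a_j^R` into the pairs (eigenvector of `ω_j`, label of `Φ_K⁺`) in which the pair `(i, k)`
is hit with probability `λ_i / K`. Birkhoff's theorem provides such injections when `λ_i dim a_j^R ≤
K`, which is the cost bound. Injectivity makes `G_jᴴ G_j` scalar, and random signs make the vectors
resolve the identity on the relevant subspace. Hence merging measurements exist
(`KoashiImotoDecomposition.exists_isExactMerging`), so the measurements chosen in the hypothesis do
merge exactly.

For the protocol, a vector in `R ⊗ S` is read as a matrix `Θ` from `ℂ^D` to `S`. The invariant of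
the induction is `Θᴴ Θ = c • 1`, that is, the state of `R` stays maximally mixed. The merging
isometries are never carried out: the parties are just measured one by one, each outcome preserves
the invariant, and finally the root alone holds a multiple of an isometric copy of `ℂ^D`, which it
undoes (`exists_isLOCC_of_mergingCostBound`). -/

/-- Two families of vectors with the same Gram matrix are related by an isometry. -/
theorem exists_linearIsometry_of_inner_eq {R E : Type} [Fintype R] [NormedAddCommGroup E]
    [InnerProductSpace ℂ E] [FiniteDimensional ℂ E] (u v : R → E)
    (h : ∀ r r', inner ℂ (u r) (u r') = inner ℂ (v r) (v r')) :
    ∃ L : E →ₗᵢ[ℂ] E, ∀ r, L (u r) = v r := by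
  classical
  let T₁ : (R → ℂ) →ₗ[ℂ] E := Fintype.linearCombination ℂ u
  let T₂ : (R → ℂ) →ₗ[ℂ] E := Fintype.linearCombination ℂ v
  have hT : ∀ a b, inner ℂ (T₁ a) (T₁ b) = inner ℂ (T₂ a) (T₂ b) := by
    intro a b
    simp only [T₁, T₂, Fintype.linearCombination_apply, sum_inner, inner_sum, inner_smul_left,
      inner_smul_right, h]
  have hn : ∀ a, ‖T₁ a‖ = ‖T₂ a‖ := by
    intro a
    have h1 := hT a a
    rw [inner_self_eq_norm_sq_to_K, inner_self_eq_norm_sq_to_K] at h1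
    have h2 : ‖T₁ a‖ ^ 2 = ‖T₂ a‖ ^ 2 := by exact_mod_cast h1
    exact (sq_eq_sq₀ (norm_nonneg _) (norm_nonneg _)).1 h2
  have hker : LinearMap.ker T₁ ≤ LinearMap.ker T₂ := by
    intro a ha
    rw [LinearMap.mem_ker] at ha ⊢
    rw [← norm_eq_zero, ← hn, ha, norm_zero]
  -- The assignment `T₁ a ↦ T₂ a` is well defined on the range of `T₁` by `hker` and isometric by
  -- `hn`; finite dimension allows it to be extended to all of `E`.
  let g : LinearMap.range T₁ →ₗ[ℂ] E :=
    (LinearMap.ker T₁).liftQ T₂ hker ∘ₗ T₁.quotKerEquivRange.symm.toLinearMap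
  have hg : ∀ a (ha : T₁ a ∈ LinearMap.range T₁), g ⟨T₁ a, ha⟩ = T₂ a := by
    intro a ha
    simp only [g, LinearMap.comp_apply, LinearEquiv.coe_coe]
    rw [LinearMap.quotKerEquivRange_symm_apply_image]
    simp
  let L : LinearMap.range T₁ →ₗᵢ[ℂ] E := ⟨g, by
    rintro ⟨_, a, rfl⟩
    exact (congrArg norm (hg a _)).trans (hn a).symm⟩
  refine ⟨L.extend, fun r => ?_⟩
  have h1 : T₁ (Pi.single r 1) = u r := by simp [T₁]
  have h2 : T₂ (Pi.single r 1) = v r := by simp [T₂]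
  have hmem : T₁ (Pi.single r 1) ∈ LinearMap.range T₁ := ⟨_, rfl⟩
  have h3 := L.extend_apply ⟨_, hmem⟩
  rw [← h1, ← h2]
  exact h3.trans (hg _ hmem)

/-- Two families of vectors with the same Gram matrix are related by an isometry, as soon as the
dimensions allow for one. -/
theorem exists_isometry_of_gram_eq {R X Y : Type} [Fintype R] [Fintype X] [Fintype Y]
    [DecidableEq X] (hXY : Fintype.card X ≤ Fintype.card Y) (u : R → X → ℂ) (v : R → Y → ℂ)
    (h : ∀ r r', ∑ x, star (u r x) * u r' x = ∑ y, star (v r y) * v r' y) :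
    ∃ W : Matrix Y X ℂ, Wᴴ * W = 1 ∧ ∀ r, W *ᵥ u r = v r := by
  classical
  obtain ⟨f⟩ := Function.Embedding.nonempty_of_card_le hXY
  -- The space of the `u r` is placed inside that of the `v r` along basis vectors, so that both
  -- families live in one space; `W` is the resulting isometry restricted to the image.
  let e : X → EuclideanSpace ℂ Y := fun x => EuclideanSpace.single (f x) 1
  have he : ∀ x x', inner ℂ (e x) (e x') = if x = x' then (1 : ℂ) else 0 := by
    intro x x'
    by_cases hx : x = x'
    · simp [e, hx]
    · simp [e, EuclideanSpace.inner_single_left, hx]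
  obtain ⟨L, hL⟩ := exists_linearIsometry_of_inner_eq (fun r => ∑ x, u r x • e x)
    (fun r => WithLp.toLp 2 (v r)) (by
      intro r r'
      have h1 : inner ℂ (∑ x, u r x • e x) (∑ x, u r' x • e x) = ∑ x, star (u r x) * u r' x := by
        simp [he, mul_comm]
      rw [h1, h]
      simp only [PiLp.inner_apply, RCLike.inner_apply]
      exact Finset.sum_congr rfl fun x _ => mul_comm _ _)
  refine ⟨Matrix.of fun y x => L (e x) y, ?_, fun r => ?_⟩
  · ext x x'
    rw [Matrix.mul_apply, Matrix.one_apply, ← he x x', ← L.inner_map_map]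
    simp only [PiLp.inner_apply, RCLike.inner_apply, Matrix.conjTranspose_apply, Matrix.of_apply]
    exact Finset.sum_congr rfl fun y _ => mul_comm _ _
  · ext y
    have h1 := congrArg (fun z : EuclideanSpace ℂ Y => z y) (hL r)
    simp only [map_sum, map_smul] at h1
    rw [← h1]
    simp [Matrix.mulVec, dotProduct, mul_comm]

/-! ### Random injections and random signs -/

/-- If `q` is a probability distribution with `d * q i ≤ 1` for all `i`, then there is a random
injection of `Fin d` for which every `x : Fin d` has an image with distribution `q`. -/
theorem exists_random_injection {I : Type} [Fintype I] [DecidableEq I] (d : ℕ) (q : I → ℝ)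
    (hq0 : ∀ i, 0 ≤ q i) (hq1 : ∑ i, q i = 1) (hqd : ∀ i, d * q i ≤ 1) :
    ∃ (e : Fin d ↪ I) (w : Equiv.Perm I → ℝ), (∀ g, 0 ≤ w g) ∧ ∑ g, w g = 1 ∧
      ∀ x i, ∑ g, (if g (e x) = i then w g else 0) = q i := by
  have hsum : ∑ i, (d * q i) = d := by rw [← Finset.mul_sum, hq1, mul_one]
  have hdn : (d : ℝ) ≤ Fintype.card I := by
    rw [← hsum]
    exact (Finset.sum_le_sum fun i _ => hqd i).trans (by simp)
  have hdn' : d ≤ Fintype.card I := by exact_mod_cast hdn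
  obtain ⟨e⟩ : Nonempty (Fin d ↪ I) := Function.Embedding.nonempty_of_card_le (by simpa using hdn')
  set n : ℝ := (Fintype.card I : ℝ) with hn
  let S : Finset I := Finset.univ.map e
  have hS : S.card = d := by simp [S]
  have hSc : ((Sᶜ : Finset I).card : ℝ) = n - d := by
    rw [Finset.card_compl, hS, Nat.cast_sub hdn']
  -- The rows in `S` are prescribed by the desired distribution; the column mass `1 - d * q i` that
  -- they leave is spread evenly over the other `n - d` rows.
  let P : Matrix I I ℝ := fun i' i => if i' ∈ S then q i else (1 - d * q i) / (n - d)
  have hP : P ∈ doublyStochastic ℝ I := by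
    rw [mem_doublyStochastic_iff_sum]
    refine ⟨fun i' i => ?_, fun i' => ?_, fun i => ?_⟩
    · simp only [P]
      split_ifs
      · exact hq0 i
      · exact div_nonneg (sub_nonneg.2 (hqd i)) (sub_nonneg.2 hdn)
    · simp only [P]
      split_ifs with h
      · exact hq1
      · have hpos : (0 : ℝ) < n - d := by
          rw [← hSc, Nat.cast_pos]
          exact Finset.card_pos.2 ⟨i', Finset.mem_compl.2 h⟩
        rw [← Finset.sum_div, Finset.sum_sub_distrib, hsum]
        simp [← hn, hpos.ne']
    · simp only [P]
      rw [← Finset.sum_add_sum_compl S, Finset.sum_congr rfl fun x hx => if_pos hx,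
        Finset.sum_congr rfl fun x hx => if_neg (Finset.mem_compl.1 hx)]
      simp only [Finset.sum_const, hS, nsmul_eq_mul, hSc]
      -- If no other rows exist, the nonnegative numbers `1 - d * q i` sum to `n - d = 0`, so each
      -- column is already full.
      by_cases hz : n - d = 0
      · have h0 : ∑ i, (1 - d * q i) = 0 := by
          rw [Finset.sum_sub_distrib, hsum]
          simpa [← hn] using hz
        have h1 := (Finset.sum_eq_zero_iff_of_nonneg fun i _ => sub_nonneg.2 (hqd i)).1 h0 i
          (Finset.mem_univ i)
        rw [hz]
        linarith
      · field_simp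
        ring
  -- Birkhoff's theorem: `P` is a convex combination of permutation matrices, and its row `e x` is
  -- the distribution of the image of `x`.
  obtain ⟨w, hw0, hw1, hwP⟩ := exists_eq_sum_perm_of_mem_doublyStochastic hP
  refine ⟨e, w, hw0, hw1, fun x i => ?_⟩
  have h1 := congrFun (congrFun hwP (e x)) i
  have h2 : P (e x) i = q i := by simp [P, S]
  rw [h2, Matrix.sum_apply] at h1
  rw [← h1]
  refine Finset.sum_congr rfl fun g _ => ?_
  simp [Equiv.Perm.permMatrix, PEquiv.toMatrix_apply]

/-- Independent random signs are orthonormal. -/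
theorem sum_units_mul {S : Type} [Fintype S] [DecidableEq S] (s t : S) :
    ∑ ε : S → ℤˣ, (((ε s : ℤ) : ℂ) * ((ε t : ℤ) : ℂ)) =
      if s = t then (Fintype.card (S → ℤˣ) : ℂ) else 0 := by
  split_ifs with h
  · subst h
    rw [Finset.sum_congr rfl fun ε _ => show (((ε s : ℤ) : ℂ) * ((ε s : ℤ) : ℂ)) = 1 by
      rcases Int.units_eq_one_or (ε s) with h | h <;> simp [h]]
    simp
  -- Flipping the sign at `s` permutes the summands and negates the sum.
  · let τ : S → ℤˣ := fun x => if x = s then -1 else 1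
    have h1 := Equiv.sum_comp (Equiv.mulLeft τ)
      fun ε : S → ℤˣ => (((ε s : ℤ) : ℂ) * ((ε t : ℤ) : ℂ))
    simp only [Equiv.coe_mulLeft, Pi.mul_apply, τ, if_true, if_neg (Ne.symm h), one_mul,
      neg_mul, Units.val_neg, Int.cast_neg, Finset.sum_neg_distrib] at h1
    exact self_eq_neg.1 h1.symm

/-- The marginal distributions of a product distribution. -/
theorem sum_pi_prod_mul {J : Type} [Fintype J] [DecidableEq J] {Ω : J → Type}
    [∀ j, Fintype (Ω j)] (w : ∀ j, Ω j → ℝ) (hw : ∀ j, ∑ o, w j o = 1) (j : J) (f : Ω j → ℝ) :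
    ∑ o : ∀ j, Ω j, (∏ i, w i (o i)) * f (o j) = ∑ o, w j o * f o := by
  -- With `f` absorbed into the `j`-th weight, the sum of products is a product of sums whose
  -- factors other than the `j`-th equal 1.
  let w' : ∀ i, Ω i → ℝ := fun i o => w i o * if h : i = j then f (h ▸ o) else 1
  have h1 : ∀ o : ∀ j, Ω j, (∏ i, w i (o i)) * f (o j) = ∏ i, w' i (o i) := by
    intro o
    simp only [w', Finset.prod_mul_distrib]
    congr 1
    rw [Finset.prod_eq_single j (fun i _ hi => dif_neg hi) (by simp)]
    simp
  rw [Finset.sum_congr rfl fun o _ => h1 o, ← Fintype.piFinset_univ, ← Finset.prod_univ_sum,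
    Finset.prod_eq_single j]
  · simp [w']
  · intro i _ hi
    simp [w', hi, hw]
  · simp

/-- The random vectors behind exact state merging: a resolution of the projection onto the
coordinates with `lam ≠ 0` into rank-one operators, each of which, weighted by `lam`, has partial
traces that are the same multiple of the identity in all blocks `j`. -/
theorem exists_block_ensemble {J : Type} [Fintype J] [DecidableEq J] (l d : J → ℕ) {K : ℕ}
    (hK : 0 < K) (lam : ∀ j, Fin (l j) → ℝ) (h0 : ∀ j i, 0 ≤ lam j i)
    (h1 : ∀ j, ∑ i, lam j i = 1) (hd : ∀ j i, lam j i * d j ≤ K) :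
    ∃ (Ω : Type) (_ : Fintype Ω) (v : Ω → (Σ j, Fin (l j) × Fin (d j)) × Fin K → ℂ) (c : Ω → ℝ),
      (∀ o, 0 ≤ c o) ∧
      (∀ y y', ∑ o, v o y * star (v o y') =
        if y = y' ∧ lam y.1.1 y.1.2.1 ≠ 0 then 1 else 0) ∧
      ∀ o j x x', ∑ i, ∑ k, (lam j i : ℂ) * (v o (⟨j, i, x⟩, k) * star (v o (⟨j, i, x'⟩, k))) =
        if x = x' then (c o : ℂ) else 0 := by
  have hK' : (0 : ℝ) < K := by exact_mod_cast hK
  -- The eigenvalue distribution times the uniform distribution of the `K` labels; `hd` is the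
  -- condition `d * q ≤ 1` required for a random injection.
  let q : ∀ j, Fin (l j) × Fin K → ℝ := fun j i => lam j i.1 / K
  have hq : ∀ j, ∑ i, q j i = 1 := by
    intro j
    simp only [q, Fintype.sum_prod_type, Finset.sum_const, Finset.card_univ, Fintype.card_fin,
      nsmul_eq_mul]
    rw [← h1 j]
    exact Finset.sum_congr rfl fun i _ => by field_simp
  choose e w hw0 hw1 hwq using fun j => exists_random_injection (d j) (q j)
    (fun i => div_nonneg (h0 j i.1) hK'.le) (hq j)
    (fun i => by
      rw [← mul_div_assoc, div_le_one hK', mul_comm]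
      exact hd j i.1)
  let S : Type := Σ j, Fin (l j) × Fin K
  let P : Type := ∀ j, Equiv.Perm (Fin (l j) × Fin K)
  let n : ℝ := Fintype.card (S → ℤˣ)
  have hn : 0 < n := by
    simp only [n, Nat.cast_pos]
    exact Fintype.card_pos
  -- The injections of the blocks are drawn independently, and the joint probability enters as one
  -- common weight; therefore the constant `c o` does not depend on the block.
  let u : P → ℝ := fun g => (∏ j, w j (g j)) / n
  have hu : ∀ g, 0 ≤ u g := fun g => div_nonneg (Finset.prod_nonneg fun j _ => hw0 j _) hn.le
  -- The factor `K / lam` compensates for the probability `lam / K` of hitting `(i, k)`. For `lam j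
  -- i = 0` the quotient is 0 by convention, so these coordinates drop out of the resolution.
  let α : P → (j : J) → Fin (l j) → Fin (d j) → Fin K → ℝ := fun g j i x k =>
    Real.sqrt (u g) * if g j (e j x) = (i, k) then Real.sqrt (K / lam j i) else 0
  have hα : ∀ g j i x x' k, x ≠ x' → α g j i x k * α g j i x' k = 0 := by
    intro g j i x x' k hx
    simp only [α]
    by_cases hg : g j (e j x) = (i, k)
    · have : g j (e j x') ≠ (i, k) := fun hg' =>
        hx ((e j).injective ((g j).injective (hg.trans hg'.symm)))
      simp [this]
    · simp [hg]
  have hα' : ∀ g j i x k, α g j i x k * α g j i x k =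
      u g * if g j (e j x) = (i, k) then K / lam j i else 0 := by
    intro g j i x k
    simp only [α]
    split_ifs
    · rw [mul_mul_mul_comm, Real.mul_self_sqrt (hu g),
        Real.mul_self_sqrt (div_nonneg hK'.le (h0 j i))]
    · simp
  have hαsum : ∀ j i x k, ∑ g, α g j i x k * α g j i x k * n = if lam j i ≠ 0 then 1 else 0 := by
    intro j i x k
    have h2 : ∀ g, α g j i x k * α g j i x k * n = (∏ j, w j (g j)) *
        (fun p => if p (e j x) = (i, k) then K / lam j i else 0) (g j) := by
      intro g
      rw [hα']
      simp only [u]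
      field_simp
    refine (Finset.sum_congr rfl fun g _ => h2 g).trans ((sum_pi_prod_mul w hw1 j
      fun p => if p (e j x) = (i, k) then K / lam j i else 0).trans ?_)
    have h3 : ∀ p : Equiv.Perm (Fin (l j) × Fin K),
        w j p * (if p (e j x) = (i, k) then K / lam j i else 0) =
        (if p (e j x) = (i, k) then w j p else 0) * (K / lam j i) := by
      intro p
      split_ifs <;> simp
    rw [Finset.sum_congr rfl fun p _ => h3 p, ← Finset.sum_mul, hwq]
    simp only [q]
    split_ifs with hl
    · field_simp
    · rw [not_not.1 hl]
      simp
  refine ⟨P × (S → ℤˣ), inferInstance,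
    fun o y => ((o.2 ⟨y.1.1, y.1.2.1, y.2⟩ : ℤ) : ℂ) * (α o.1 y.1.1 y.1.2.1 y.1.2.2 y.2 : ℂ),
    fun o => K * u o.1, fun o => mul_nonneg hK'.le (hu _), ?_, ?_⟩
  · rintro ⟨⟨j, i, x⟩, k⟩ ⟨⟨j', i', x'⟩, k'⟩
    -- Averaging over the signs removes all off-diagonal terms with different `(j, i, k)`; those
    -- with different `x` only are removed by injectivity (`hα`).
    have h2 : ∀ g : P, ∑ ε : S → ℤˣ,
        (((ε ⟨j, i, k⟩ : ℤ) : ℂ) * (α g j i x k : ℂ)) *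
          star (((ε ⟨j', i', k'⟩ : ℤ) : ℂ) * (α g j' i' x' k' : ℂ)) =
        (α g j i x k : ℂ) * (α g j' i' x' k' : ℂ) *
          if (⟨j, i, k⟩ : S) = ⟨j', i', k'⟩ then (Fintype.card (S → ℤˣ) : ℂ) else 0 := by
      intro g
      rw [← sum_units_mul, Finset.mul_sum]
      refine Finset.sum_congr rfl fun ε _ => ?_
      simp only [star_mul', Complex.star_def, Complex.conj_ofReal, map_intCast]
      ring
    rw [Fintype.sum_prod_type, Finset.sum_congr rfl fun g _ => h2 g]
    by_cases hs : (⟨j, i, k⟩ : S) = ⟨j', i', k'⟩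
    · obtain rfl : j = j' := congrArg Sigma.fst hs
      simp only [Sigma.mk.injEq, heq_eq_eq, Prod.mk.injEq, true_and] at hs
      obtain ⟨rfl, rfl⟩ := hs
      by_cases hx : x = x'
      · subst hx
        have h3 := hαsum j i x k
        simp only [if_true, true_and]
        rw [← Complex.ofReal_inj] at h3
        push_cast [n] at h3
        rw [h3]
        split_ifs <;> simp
      · trans 0
        · refine Finset.sum_eq_zero fun g _ => ?_
          rw [← Complex.ofReal_mul, hα g j i x x' k hx]
          simp
        · simp [hx]
    · simp only [if_neg hs, mul_zero, Finset.sum_const_zero]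
      rw [if_neg]
      · rintro ⟨h, -⟩
        apply hs
        simp only [Prod.mk.injEq, Sigma.mk.injEq] at h
        obtain ⟨⟨rfl, h⟩, rfl⟩ := h
        simp only [heq_eq_eq, Prod.mk.injEq] at h
        rw [h.1]
  · rintro ⟨g, ε⟩ j x x'
    have h2 : ∀ i k, (lam j i : ℂ) *
        ((((ε ⟨j, i, k⟩ : ℤ) : ℂ) * (α g j i x k : ℂ)) *
          star (((ε ⟨j, i, k⟩ : ℤ) : ℂ) * (α g j i x' k : ℂ))) =
        ((lam j i * (α g j i x k * α g j i x' k) : ℝ) : ℂ) := by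
      intro i k
      rcases Int.units_eq_one_or (ε ⟨j, i, k⟩) with h | h <;> simp [h]
    simp only [h2]
    split_ifs with hx
    · subst hx
      rw [← Fintype.sum_prod_type' (f := fun i k =>
        ((lam j i * (α g j i x k * α g j i x k) : ℝ) : ℂ)), ← Complex.ofReal_sum,
        Finset.sum_eq_single (g j (e j x))]
      · rw [hα', if_pos rfl]
        -- An injection that hits a coordinate with `lam = 0` has probability 0, so both sides
        -- vanish.
        by_cases hl : lam j (g j (e j x)).1 = 0
        · have h3 : w j (g j) = 0 := by
            have h4 := hwq j x (g j (e j x))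
            simp only [q, hl, zero_div] at h4
            have h5 := (Finset.sum_eq_zero_iff_of_nonneg (fun p _ => by
              split_ifs
              exacts [hw0 j p, le_rfl])).1 h4 (g j) (Finset.mem_univ _)
            simpa using h5
          have h6 : u g = 0 := by
            simp only [u]
            rw [Finset.prod_eq_zero (Finset.mem_univ j) h3, zero_div]
          simp [h6]
        · congr 1
          field_simp
      · intro z _ hz
        rw [hα', if_neg (Ne.symm hz)]
        simp
      · simp
    · refine Finset.sum_eq_zero fun i _ => Finset.sum_eq_zero fun k _ => ?_
      rw [hα g j i x x' k hx]
      simp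

/-! ### Exact state merging from a Koashi–Imoto decomposition -/

/-- An operator with `Gᴴ * G = c • 1` multiplies all Gram matrices by `c`. -/
theorem sum_star_mul_of_gram {Z X Y : Type} [Fintype Z] [Fintype X] [Fintype Y] [DecidableEq X]
    (G : Matrix Z X ℂ) (c : ℂ) (hG : Gᴴ * G = c • (1 : Matrix X X ℂ)) (Φ Φ' : Matrix X Y ℂ) :
    ∑ y, ∑ z, star ((G * Φ) z y) * (G * Φ') z y = c * ∑ y, ∑ x, star (Φ x y) * Φ' x y := by
  have h : (G * Φ)ᴴ * (G * Φ') = c • (Φᴴ * Φ') := by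
    rw [Matrix.conjTranspose_mul, Matrix.mul_assoc, ← Matrix.mul_assoc Gᴴ, hG,
      Matrix.smul_mul, Matrix.one_mul, Matrix.mul_smul]
  have h' := congrArg Matrix.trace h
  rw [Matrix.trace_smul, smul_eq_mul] at h'
  exact h'

/-- The Gram matrix of the components of `ψ` along `R`, expressed by a Koashi–Imoto
decomposition. -/
def KoashiImotoDecomposition.blockGram {R A B : Type} [Fintype R] [Fintype A] [Fintype B]
    {ψ : R → A → B → ℂ} (δ : KoashiImotoDecomposition ψ) (r r' : R) : ℂ :=
  ∑ j, (δ.p j : ℂ) * ∑ y, ∑ x, star (δ.φ j r x y) * δ.φ j r' x y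

/-- Contracting `ψ` with the columns of `U` turns `φ_j` into its image under an operator on `a_j^R`,
and `hc` makes this operator a multiple of an isometry with one constant for all blocks. Different
blocks do not interfere because `embB` is isometric. The case `U = 1`, `c = 1` yields the Gram
matrix of `ψ`; a measurement vector on `A ⊗ ℂ^K`, read as a matrix, yields that of the measured
state. -/
theorem KoashiImotoDecomposition.sum_star_mul {R A B κ : Type} [Fintype R] [Fintype A]
    [Fintype B] [Fintype κ] {ψ : R → A → B → ℂ} (δ : KoashiImotoDecomposition ψ)
    (lam : ∀ j, Fin (δ.aL j) → ℝ)
    (hω : ∀ j, δ.ω j * (δ.ω j)ᴴ = Matrix.diagonal fun i => (lam j i : ℂ))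
    (U : Matrix A κ ℂ) (c : ℂ)
    (hc : ∀ j x x', ∑ i, ∑ k, (lam j i : ℂ) *
      ((δ.embAᴴ * U) ⟨j, i, x⟩ k * star ((δ.embAᴴ * U) ⟨j, i, x'⟩ k)) = if x = x' then c else 0)
    (r r' : R) :
    ∑ k, ∑ b, star (∑ a, star (U a k) * ψ r a b) * (∑ a, star (U a k) * ψ r' a b) =
      c * δ.blockGram r r' := by
  set N := δ.embAᴴ * U with hN
  -- `G j` maps `a_j^R` to `κ ⊗ b_j^L`: it is what remains of `ω j` and the measurement vectors
  -- after contraction over `a_j^L`.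
  let G : ∀ j, Matrix (κ × Fin (δ.bL j)) (Fin (δ.aR j)) ℂ := fun j =>
    Matrix.of fun z x => ∑ i, star (N ⟨j, i, x⟩ z.1) * δ.ω j i z.2
  have hG : ∀ j, (G j)ᴴ * G j = c • (1 : Matrix (Fin (δ.aR j)) (Fin (δ.aR j)) ℂ) := by
    intro j
    ext x x'
    have h1 : (c • (1 : Matrix (Fin (δ.aR j)) (Fin (δ.aR j)) ℂ)) x x' =
        if x = x' then c else 0 := by
      simp [Matrix.one_apply]
    rw [h1, ← hc j x x', Matrix.mul_apply, Fintype.sum_prod_type]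
    conv_rhs => rw [Finset.sum_comm]
    refine Finset.sum_congr rfl fun k _ => ?_
    have h2 : ∀ i i', ∑ y, δ.ω j i y * star (δ.ω j i' y) =
        if i = i' then (lam j i : ℂ) else 0 := by
      intro i i'
      have := congrFun (congrFun (hω j) i) i'
      rw [Matrix.mul_apply, Matrix.diagonal_apply] at this
      exact this
    calc ∑ y, (G j)ᴴ x (k, y) * G j (k, y) x'
        = ∑ y, ∑ i, ∑ i', N ⟨j, i, x⟩ k * star (N ⟨j, i', x'⟩ k) *
            (δ.ω j i' y * star (δ.ω j i y)) := by
          refine Finset.sum_congr rfl fun y _ => ?_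
          simp only [G, Matrix.conjTranspose_apply, Matrix.of_apply, star_sum, Finset.sum_mul_sum,
            star_mul', star_star]
          refine Finset.sum_congr rfl fun i _ => Finset.sum_congr rfl fun i' _ => ?_
          ring
      _ = ∑ i, ∑ i', N ⟨j, i, x⟩ k * star (N ⟨j, i', x'⟩ k) *
            ∑ y, (δ.ω j i' y * star (δ.ω j i y)) := by
          rw [Finset.sum_comm]
          refine Finset.sum_congr rfl fun i _ => ?_
          rw [Finset.sum_comm]
          refine Finset.sum_congr rfl fun i' _ => ?_
          rw [Finset.mul_sum]
      _ = _ := by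
          simp only [h2]
          refine Finset.sum_congr rfl fun i _ => ?_
          simp [mul_comm]
  let f : R → κ → (Σ j, Fin (δ.bL j) × Fin (δ.bR j)) → ℂ := fun r k Y =>
    (Real.sqrt (δ.p Y.1) : ℂ) * (G Y.1 * Matrix.of (δ.φ Y.1 r)) (k, Y.2.1) Y.2.2
  have hf : ∀ r k b, ∑ a, star (U a k) * ψ r a b = (δ.embB *ᵥ f r k) b := by
    intro r k b
    simp only [Matrix.mulVec, dotProduct, Fintype.sum_sigma, δ.decomp, f]
    have h3 : ∀ j (x : Fin (δ.aL j) × Fin (δ.aR j)),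
        star (N ⟨j, x⟩ k) = ∑ a, star (U a k) * δ.embA a ⟨j, x⟩ := by
      intro j x
      simp only [N, Matrix.mul_apply, star_sum, star_mul', Matrix.conjTranspose_apply, star_star]
      exact Finset.sum_congr rfl fun a _ => mul_comm _ _
    calc ∑ a, star (U a k) * ∑ j, (Real.sqrt (δ.p j) : ℂ) *
          ∑ x : Fin (δ.aL j) × Fin (δ.aR j), ∑ y : Fin (δ.bL j) × Fin (δ.bR j),
            δ.embA a ⟨j, x⟩ * δ.embB b ⟨j, y⟩ * (δ.ω j x.1 y.1 * δ.φ j r x.2 y.2)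
        = ∑ j, ∑ x : Fin (δ.aL j) × Fin (δ.aR j), ∑ y : Fin (δ.bL j) × Fin (δ.bR j),
            δ.embB b ⟨j, y⟩ * (Real.sqrt (δ.p j) : ℂ) * star (N ⟨j, x⟩ k) *
              (δ.ω j x.1 y.1 * δ.φ j r x.2 y.2) := by
          simp only [Finset.mul_sum]
          rw [Finset.sum_comm]
          refine Finset.sum_congr rfl fun j _ => ?_
          rw [Finset.sum_comm]
          refine Finset.sum_congr rfl fun x _ => ?_
          rw [Finset.sum_comm]
          refine Finset.sum_congr rfl fun y _ => ?_
          rw [h3, Finset.mul_sum, Finset.sum_mul]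
          refine Finset.sum_congr rfl fun a _ => ?_
          ring
      _ = _ := by
          refine Finset.sum_congr rfl fun j _ => ?_
          rw [Finset.sum_comm]
          refine Finset.sum_congr rfl fun y _ => ?_
          rw [Fintype.sum_prod_type, Finset.sum_comm]
          simp only [Matrix.mul_apply, G, Matrix.of_apply, Finset.sum_mul, Finset.mul_sum]
          refine Finset.sum_congr rfl fun x _ => Finset.sum_congr rfl fun i _ => ?_
          ring
  have hB : ∀ k, ∑ b, star (∑ a, star (U a k) * ψ r a b) * (∑ a, star (U a k) * ψ r' a b) =
      ∑ Y, star (f r k Y) * f r' k Y := by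
    intro k
    simp only [hf]
    change star (δ.embB *ᵥ f r k) ⬝ᵥ (δ.embB *ᵥ f r' k) = star (f r k) ⬝ᵥ f r' k
    rw [Matrix.star_mulVec, ← Matrix.dotProduct_mulVec, Matrix.mulVec_mulVec, δ.embB_isometry,
      Matrix.one_mulVec]
  simp only [hB, Fintype.sum_sigma]
  rw [Finset.sum_comm, KoashiImotoDecomposition.blockGram, Finset.mul_sum]
  refine Finset.sum_congr rfl fun j _ => ?_
  have h4 := sum_star_mul_of_gram (G j) c (hG j) (Matrix.of (δ.φ j r)) (Matrix.of (δ.φ j r'))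
  simp only [Matrix.of_apply] at h4
  rw [mul_left_comm, ← h4]
  have hp : ((Real.sqrt (δ.p j) : ℂ)) * (Real.sqrt (δ.p j) : ℂ) = δ.p j := by
    rw [← Complex.ofReal_mul, Real.mul_self_sqrt (δ.p_nonneg j)]
  simp only [f, Fintype.sum_prod_type, star_mul', Complex.star_def, Complex.conj_ofReal, ← hp,
    Finset.mul_sum]
  conv_rhs => rw [Finset.sum_comm]
  refine Finset.sum_congr rfl fun k _ => ?_
  rw [Finset.sum_comm]
  refine Finset.sum_congr rfl fun y _ => Finset.sum_congr rfl fun i _ => ?_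
  ring

/-- If the measured states have Gram matrices proportional to that of `ψ`, then they are related
to `ψ` by isometries. -/
theorem exists_merging_isometry {R A B : Type} [Fintype R] [Fintype A] [Fintype B] [Nonempty A]
    [Nonempty B] {K : ℕ} [DecidableEq (B × Fin K)] (ψ : R → A → B → ℂ) (m : A × Fin K → ℂ)
    (c : ℝ) (hc : 0 ≤ c)
    (h : ∀ r r', ∑ y, star (measured ψ m r y) * measured ψ m r' y =
      c * ∑ a, ∑ b, star (ψ r a b) * ψ r' a b) :
    ∃ (d : ℕ) (W : Matrix ((A × B) × Fin d) (B × Fin K) ℂ) (χ : Fin d → ℂ),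
      Wᴴ * W = 1 ∧ ∀ r a b i, ∑ y, W ((a, b), i) y * measured ψ m r y = χ i * ψ r a b := by
  classical
  -- The auxiliary dimension only has to be positive and large enough for an isometry out of `B ×
  -- Fin K`; a single basis vector of it is used, with norm `√c`.
  let χ : Fin (Fintype.card (B × Fin K) + 1) → ℂ := Pi.single 0 ((Real.sqrt c : ℝ) : ℂ)
  obtain ⟨W, hW, hW'⟩ := exists_isometry_of_gram_eq (X := B × Fin K)
    (Y := (A × B) × Fin (Fintype.card (B × Fin K) + 1)) (by
      rw [Fintype.card_prod (A × B), Fintype.card_fin]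
      exact (Nat.le_succ _).trans (Nat.le_mul_of_pos_left _ Fintype.card_pos))
    (measured ψ m) (fun r y => χ y.2 * ψ r y.1.1 y.1.2) (fun r r' => by
      rw [h, Fintype.sum_prod_type, Finset.mul_sum, Fintype.sum_prod_type]
      refine Finset.sum_congr rfl fun a _ => ?_
      rw [Finset.mul_sum]
      refine Finset.sum_congr rfl fun b _ => ?_
      rw [Finset.sum_eq_single 0 (fun i _ hi => by simp [χ, hi]) (by simp)]
      have hc' : ((Real.sqrt c : ℝ) : ℂ) * (Real.sqrt c : ℝ) = c := by
        rw [← Complex.ofReal_mul, Real.mul_self_sqrt hc]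
      simp only [χ, Pi.single_eq_same, star_mul', Complex.star_def, Complex.conj_ofReal, ← hc']
      ring)
  exact ⟨_, W, χ, hW, fun r a b i => congrFun (hW' r) ((a, b), i)⟩

/-- A Koashi–Imoto decomposition can be rotated on `A` so that the reduced states on the `a_j^L`
become diagonal. -/
theorem KoashiImotoDecomposition.exists_diagonal {R A B : Type} [Fintype R] [Fintype A]
    [Fintype B] {ψ : R → A → B → ℂ} (δ : KoashiImotoDecomposition ψ) {K : ℕ} (hK : 0 < K)
    (hδ : δ.CostAtMost K) :
    ∃ (δ' : KoashiImotoDecomposition ψ) (lam : ∀ j, Fin (δ'.aL j) → ℝ),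
      (∀ j, δ'.ω j * (δ'.ω j)ᴴ = Matrix.diagonal fun i => (lam j i : ℂ)) ∧
      (∀ j i, 0 ≤ lam j i) ∧ (∀ j, ∑ i, lam j i = 1) ∧
      ∀ j i, lam j i * δ'.aR j ≤ K := by
  let H := fun j => Matrix.isHermitian_mul_conjTranspose_self (δ.ω j)
  -- Each `a_j^L` is rotated to an eigenbasis of its reduced state; the rotation `V j ⊗ 1` absorbed
  -- in `embA` leaves `ψ` unchanged.
  let V : ∀ j, Matrix (Fin (δ.aL j)) (Fin (δ.aL j)) ℂ := fun j => (H j).eigenvectorUnitary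
  have hV : ∀ j, (V j)ᴴ * V j = 1 := fun j => Matrix.UnitaryGroup.star_mul_self _
  have hV' : ∀ j, V j * (V j)ᴴ = 1 := fun j => mul_eq_one_comm.1 (hV j)
  let Q : Matrix (Σ j, Fin (δ.aL j) × Fin (δ.aR j)) (Σ j, Fin (δ.aL j) × Fin (δ.aR j)) ℂ :=
    Matrix.blockDiagonal' fun j => V j ⊗ₖ (1 : Matrix (Fin (δ.aR j)) (Fin (δ.aR j)) ℂ)
  have hQ : Qᴴ * Q = 1 := by
    simp only [Q, Matrix.blockDiagonal'_conjTranspose, ← Matrix.blockDiagonal'_mul,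
      Matrix.conjTranspose_kronecker, ← Matrix.mul_kronecker_mul, hV, Matrix.conjTranspose_one,
      Matrix.mul_one, Matrix.one_kronecker_one]
    exact Matrix.blockDiagonal'_one
  have hunit : ∀ j, (δ.ω j * (δ.ω j)ᴴ).trace = 1 := by
    intro j
    have h := δ.ω_unit j
    rw [← Complex.ofReal_inj] at h
    push_cast at h
    rw [← h]
    simp only [Matrix.trace, Matrix.diag_apply, Matrix.mul_apply, Matrix.conjTranspose_apply,
      Complex.star_def, Complex.mul_conj']
  have hemb : ∀ a j i x, (δ.embA * Q) a ⟨j, i, x⟩ = ∑ z, δ.embA a ⟨j, z, x⟩ * V j z i := by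
    intro a j i x
    simp only [Matrix.mul_apply, Fintype.sum_sigma, Q]
    rw [Finset.sum_eq_single j]
    · rw [Fintype.sum_prod_type]
      refine Finset.sum_congr rfl fun z _ => ?_
      rw [Finset.sum_eq_single x]
      · simp [Matrix.blockDiagonal'_apply_eq]
      · intro y _ hy
        simp [Matrix.blockDiagonal'_apply_eq, Matrix.one_apply_ne hy]
      · simp
    · intro j' _ hj
      refine Finset.sum_eq_zero fun y _ => ?_
      rw [Matrix.blockDiagonal'_apply_ne _ _ _ hj, mul_zero]
    · simp
  have hdiag : ∀ j, ((V j)ᴴ * δ.ω j) * ((V j)ᴴ * δ.ω j)ᴴ =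
      Matrix.diagonal fun i => (((H j).eigenvalues i : ℝ) : ℂ) := by
    intro j
    have h := (H j).conjStarAlgAut_star_eigenvectorUnitary
    rw [Unitary.conjStarAlgAut_apply] at h
    simp only [Matrix.conjTranspose_mul, Matrix.conjTranspose_conjTranspose]
    rw [Matrix.mul_assoc, ← Matrix.mul_assoc (δ.ω j), ← Matrix.mul_assoc]
    simpa [V, Matrix.star_eq_conjTranspose, Function.comp_def] using h
  refine ⟨{ δ with
    embA := δ.embA * Q
    embA_isometry := ?_
    ω := fun j => (V j)ᴴ * δ.ω j
    ω_unit := ?_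
    decomp := ?_ }, fun j i => (H j).eigenvalues i, hdiag, ?_, ?_, ?_⟩
  · rw [Matrix.conjTranspose_mul, Matrix.mul_assoc, ← Matrix.mul_assoc δ.embAᴴ, δ.embA_isometry,
      Matrix.one_mul, hQ]
  · intro j
    have h : ((((V j)ᴴ * δ.ω j) * ((V j)ᴴ * δ.ω j)ᴴ).trace : ℂ) = 1 := by
      rw [Matrix.conjTranspose_mul, Matrix.conjTranspose_conjTranspose, Matrix.mul_assoc,
        Matrix.trace_mul_comm, Matrix.mul_assoc, Matrix.mul_assoc, hV', Matrix.mul_one, hunit]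
    rw [← Complex.ofReal_inj, Complex.ofReal_one, ← h]
    push_cast
    rw [Matrix.trace]
    refine Finset.sum_congr rfl fun i _ => ?_
    rw [Matrix.diag_apply, Matrix.mul_apply]
    refine Finset.sum_congr rfl fun k _ => ?_
    rw [Matrix.conjTranspose_apply, Complex.star_def, Complex.mul_conj']
  · intro r a b
    rw [δ.decomp]
    refine Finset.sum_congr rfl fun j _ => ?_
    congr 1
    rw [Finset.sum_comm]
    conv_rhs => rw [Finset.sum_comm]
    refine Finset.sum_congr rfl fun y _ => ?_
    rw [Fintype.sum_prod_type, Finset.sum_comm]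
    conv_rhs => rw [Fintype.sum_prod_type, Finset.sum_comm]
    refine Finset.sum_congr rfl fun x _ => ?_
    have h : ∀ z, δ.ω j z y.1 = ∑ i, V j z i * ((V j)ᴴ * δ.ω j) i y.1 := by
      intro z
      have : δ.ω j = V j * ((V j)ᴴ * δ.ω j) := by
        rw [← Matrix.mul_assoc, hV', Matrix.one_mul]
      exact (congrFun (congrFun this z) y.1).trans (Matrix.mul_apply ..)
    simp only [hemb, h, Finset.sum_mul, Finset.mul_sum]
    rw [Finset.sum_comm]
    refine Finset.sum_congr rfl fun i _ => Finset.sum_congr rfl fun z _ => ?_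
    ring
  · intro j i
    exact (Matrix.posSemidef_self_mul_conjTranspose (δ.ω j)).eigenvalues_nonneg i
  · intro j
    have h := (H j).trace_eq_sum_eigenvalues
    rw [hunit] at h
    have h' : ((∑ i, (H j).eigenvalues i : ℝ) : ℂ) = ((1 : ℝ) : ℂ) := by
      push_cast
      exact h.symm
    exact Complex.ofReal_injective h'
  · intro j i
    have h1 : (H j).eigenvalues i ≤ δ.maxEigenvalue j :=
      le_ciSup (f := (H j).eigenvalues) (Set.finite_range _).bddAbove i
    have h2 : ⌈δ.maxEigenvalue j * (δ.aR j : ℝ)⌉₊ ≤ K := by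
      -- The logarithms can be compared only for positive arguments: `logb 2 0` has the default
      -- value 0, so a vanishing ceiling is treated apart.
      rcases Nat.eq_zero_or_pos ⌈δ.maxEigenvalue j * (δ.aR j : ℝ)⌉₊ with h | h
      · omega
      · have := (Real.logb_le_logb (by norm_num : (1 : ℝ) < 2) (by exact_mod_cast h)
          (by exact_mod_cast hK)).1 (hδ j)
        exact_mod_cast this
    calc (H j).eigenvalues i * (δ.aR j : ℝ) ≤ δ.maxEigenvalue j * δ.aR j := by gcongr
      _ ≤ (⌈δ.maxEigenvalue j * (δ.aR j : ℝ)⌉₊ : ℝ) := Nat.le_ceil _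
      _ ≤ K := by exact_mod_cast h2

/-- Only nonempty systems admit Koashi–Imoto decompositions. -/
theorem KoashiImotoDecomposition.nonempty_systems {R A B : Type} [Fintype R] [Fintype A]
    [Fintype B] {ψ : R → A → B → ℂ} (δ : KoashiImotoDecomposition ψ) :
    Nonempty A ∧ Nonempty B := by
  have hJ : 0 < δ.J := by
    rcases Nat.eq_zero_or_pos δ.J with h | h
    · have h' : ∑ j, δ.p j = 0 := Finset.sum_eq_zero fun j _ => absurd j.isLt (by omega)
      exact absurd (δ.p_sum.symm.trans h') one_ne_zero
    · exact h
  let j : Fin δ.J := ⟨0, hJ⟩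
  have hω : ∃ x y, δ.ω j x y ≠ 0 := by
    by_contra! h
    have := δ.ω_unit j
    simp [h] at this
  have hφ : ∃ r x y, δ.φ j r x y ≠ 0 := by
    by_contra! h
    have := δ.φ_unit j
    simp [h] at this
  obtain ⟨x, y, -⟩ := hω
  obtain ⟨r, x', y', -⟩ := hφ
  constructor
  · by_contra h
    rw [not_nonempty_iff] at h
    have := congrFun (congrFun δ.embA_isometry ⟨j, x, x'⟩) ⟨j, x, x'⟩
    simp [Matrix.mul_apply] at this
  · by_contra h
    rw [not_nonempty_iff] at h
    have := congrFun (congrFun δ.embB_isometry ⟨j, y, y'⟩) ⟨j, y, y'⟩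
    simp [Matrix.mul_apply] at this

/-- Exact state merging is possible whenever the cost of a Koashi–Imoto decomposition is at most
`log₂ K`. -/
theorem KoashiImotoDecomposition.exists_isExactMerging {R A B : Type} [Fintype R] [Fintype A]
    [Fintype B] {ψ : R → A → B → ℂ} (δ₀ : KoashiImotoDecomposition ψ) {K : ℕ} (hK : 0 < K)
    (hδ : δ₀.CostAtMost K) :
    ∃ (n : ℕ) (m : Fin n → A × Fin K → ℂ), IsExactMerging ψ m := by
  classical
  obtain ⟨δ, lam, hω, hlam0, hlam1, hlamK⟩ := δ₀.exists_diagonal hK hδ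
  obtain ⟨hA, hB⟩ := δ.nonempty_systems
  obtain ⟨Ω, _, v, c, hc0, hv, hvc⟩ := exists_block_ensemble δ.aL δ.aR hK lam hlam0 hlam1 hlamK
  let F : Matrix (A × Fin K) ((Σ j, Fin (δ.aL j) × Fin (δ.aR j)) × Fin K) ℂ :=
    δ.embA ⊗ₖ (1 : Matrix (Fin K) (Fin K) ℂ)
  have hF : Fᴴ * F = 1 := by
    simp only [F, Matrix.conjTranspose_kronecker, ← Matrix.mul_kronecker_mul, δ.embA_isometry,
      Matrix.conjTranspose_one, Matrix.mul_one, Matrix.one_kronecker_one]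
  let v' : Matrix ((Σ j, Fin (δ.aL j) × Fin (δ.aR j)) × Fin K) Ω ℂ := Matrix.of fun y o => v o y
  let Q : Matrix ((Σ j, Fin (δ.aL j) × Fin (δ.aR j)) × Fin K)
      ((Σ j, Fin (δ.aL j) × Fin (δ.aR j)) × Fin K) ℂ :=
    Matrix.diagonal fun y => if lam y.1.1 y.1.2.1 ≠ 0 then 1 else 0
  have hvQ : v' * v'ᴴ = Q := by
    ext y y'
    refine (Matrix.mul_apply ..).trans ((hv y y').trans ?_)
    refine Eq.trans ?_ (Matrix.diagonal_apply ..).symm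
    by_cases h : y = y' <;> simp [h]
  have hQQ : Q * Q = Q := by
    rw [Matrix.diagonal_mul_diagonal]
    congr 1
    ext y
    split_ifs <;> simp
  have hQH : Qᴴ = Q := by rw [← hvQ, Matrix.conjTranspose_mul, Matrix.conjTranspose_conjTranspose]
  -- The projection onto the part of `A ⊗ ℂ^K` where `ψ` has weight, which is all that the ensemble
  -- resolves.
  let P : Matrix (A × Fin K) (A × Fin K) ℂ := F * Q * Fᴴ
  have hPP : P * P = P := by
    calc F * Q * Fᴴ * (F * Q * Fᴴ) = F * Q * (Fᴴ * F) * Q * Fᴴ := by simp only [Matrix.mul_assoc]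
      _ = F * (Q * Q) * Fᴴ := by rw [hF, Matrix.mul_one, Matrix.mul_assoc F]
      _ = P := by rw [hQQ]
  have hPH : Pᴴ = P := by
    simp only [P, Matrix.conjTranspose_mul, Matrix.conjTranspose_conjTranspose, hQH,
      Matrix.mul_assoc]
  have hFP : Fᴴ * (1 - P) = (1 - Q) * Fᴴ := by
    rw [Matrix.mul_sub, Matrix.sub_mul, Matrix.mul_one, Matrix.one_mul]
    congr 1
    calc Fᴴ * (F * Q * Fᴴ) = (Fᴴ * F) * Q * Fᴴ := by simp only [Matrix.mul_assoc]
      _ = Q * Fᴴ := by rw [hF, Matrix.one_mul]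
  -- The columns of the projection `1 - P` complete the ensemble to a resolution of the identity.
  let m : Ω ⊕ (A × Fin K) → A × Fin K → ℂ := Sum.elim (fun o z => (F * v') z o)
    (fun z' z => (1 - P) z z')
  have hm : ∑ o, Matrix.vecMulVec (m o) (star (m o)) = 1 := by
    have h1 : ∑ o, Matrix.vecMulVec (m o) (star (m o)) =
        (F * v') * (F * v')ᴴ + (1 - P) * (1 - P)ᴴ := by
      rw [Fintype.sum_sum_type]
      congr 1 <;>
      · ext z z'
        rw [Matrix.sum_apply, Matrix.mul_apply]
        rfl
    rw [h1, Matrix.conjTranspose_mul, Matrix.conjTranspose_sub, Matrix.conjTranspose_one, hPH,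
      Matrix.mul_assoc, ← Matrix.mul_assoc v', hvQ, ← Matrix.mul_assoc]
    change P + _ = 1
    rw [Matrix.mul_sub, Matrix.sub_mul, Matrix.sub_mul, hPP]
    simp
  have hcond : ∀ o, ∃ c' : ℝ, 0 ≤ c' ∧ ∀ j x x', ∑ i, ∑ k, (lam j i : ℂ) *
      ((Fᴴ *ᵥ m o) (⟨j, i, x⟩, k) * star ((Fᴴ *ᵥ m o) (⟨j, i, x'⟩, k))) =
        if x = x' then (c' : ℂ) else 0 := by
    rintro (o | z)
    · refine ⟨c o, hc0 o, fun j x x' => ?_⟩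
      have h1 : Fᴴ *ᵥ m (Sum.inl o) = v o := by
        have h2 : Fᴴ * (F * v') = v' := by rw [← Matrix.mul_assoc, hF, Matrix.one_mul]
        ext y
        exact congrFun (congrFun h2 y) o
      rw [h1]
      exact hvc o j x x'
    -- The added outcomes have probability 0: in block coordinates they are supported where `lam =
    -- 0`.
    · refine ⟨0, le_rfl, fun j x x' => ?_⟩
      let Z : Matrix ((Σ j, Fin (δ.aL j) × Fin (δ.aR j)) × Fin K) (A × Fin K) ℂ := (1 - Q) * Fᴴ
      have h1 : ∀ y, (Fᴴ *ᵥ m (Sum.inr z)) y = Z y z := fun y =>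
        congrFun (congrFun hFP y) z
      have h2 : ∀ y, Z y z = (1 - if lam y.1.1 y.1.2.1 ≠ 0 then 1 else 0) * Fᴴ y z := by
        intro y
        simp only [Z, Q]
        rw [Matrix.sub_mul, Matrix.one_mul, Matrix.sub_apply, Matrix.diagonal_mul]
        ring
      rw [Finset.sum_eq_zero]
      · simp
      · intro i _
        refine Finset.sum_eq_zero fun k _ => ?_
        rw [h1, h2]
        by_cases hl : lam j i = 0 <;> simp [hl]
  have hψ : ∀ r r', ∑ a, ∑ b, star (ψ r a b) * ψ r' a b = δ.blockGram r r' := by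
    intro r r'
    have h1 := δ.sum_star_mul lam hω (1 : Matrix A A ℂ) 1 (by
      intro j x x'
      have h2 : ∀ i, ∑ a, δ.embAᴴ ⟨j, i, x⟩ a * star (δ.embAᴴ ⟨j, i, x'⟩ a) =
          if x = x' then 1 else 0 := by
        intro i
        have := congrFun (congrFun δ.embA_isometry ⟨j, i, x⟩) ⟨j, i, x'⟩
        rw [Matrix.mul_apply, Matrix.one_apply] at this
        simpa using this
      simp only [Matrix.mul_one, ← Finset.mul_sum, h2]
      rw [← Finset.sum_mul, ← Complex.ofReal_sum, hlam1]
      simp) r r'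
    rw [one_mul] at h1
    rw [← h1]
    simp [Matrix.one_apply]
  have hmeas : ∀ o r (y : B × Fin K), measured ψ (m o) r y =
      ∑ a, star (m o (a, y.2) * ((1 / Real.sqrt K : ℝ) : ℂ)) * ψ r a y.1 := by
    intro o r y
    simp only [measured, maxEnt]
    refine Finset.sum_congr rfl fun a _ => ?_
    rw [Finset.sum_eq_single y.2 (fun k _ hk => by simp [hk]) (by simp)]
    rw [star_mul', Complex.star_def, Complex.conj_ofReal, if_pos rfl]
    ring
  refine ⟨Fintype.card (Ω ⊕ (A × Fin K)), fun o => m ((Fintype.equivFin _).symm o), ?_, ?_⟩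
  · exact (Equiv.sum_comp (Fintype.equivFin (Ω ⊕ (A × Fin K))).symm
      fun o => Matrix.vecMulVec (m o) (star (m o))).trans hm
  · intro o'
    beta_reduce
    generalize (Fintype.equivFin (Ω ⊕ (A × Fin K))).symm o' = o
    obtain ⟨c', hc', h⟩ := hcond o
    -- The divisor `K` is the square of the amplitude `1 / √K` of `Φ_K⁺`.
    refine exists_merging_isometry ψ (m o) (c' / K) (by positivity) fun r r' => ?_
    rw [hψ]
    have hs : ((1 / Real.sqrt K : ℝ) : ℂ) * ((1 / Real.sqrt K : ℝ) : ℂ) = 1 / K := by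
      rw [← Complex.ofReal_mul, div_mul_div_comm, Real.mul_self_sqrt (Nat.cast_nonneg K)]
      simp
    have h1 := δ.sum_star_mul lam hω
      (Matrix.of fun a k => m o (a, k) * ((1 / Real.sqrt K : ℝ) : ℂ)) ((c' / K : ℝ) : ℂ) (by
      intro j x x'
      have h2 : ∀ y k, (δ.embAᴴ * Matrix.of fun a k => m o (a, k) * ((1 / Real.sqrt K : ℝ) : ℂ)) y k =
          (Fᴴ *ᵥ m o) (y, k) * ((1 / Real.sqrt K : ℝ) : ℂ) := by
        intro y k
        simp only [Matrix.mul_apply, Matrix.mulVec, dotProduct, Fintype.sum_prod_type,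
          Matrix.of_apply, Finset.sum_mul]
        refine Finset.sum_congr rfl fun a _ => ?_
        rw [Finset.sum_eq_single k]
        · simp [F, mul_assoc]
        · intro k' _ hk'
          simp [F, Matrix.one_apply_ne hk']
        · simp
      have h3 := congrArg (fun t => t * (1 / K : ℂ)) (h j x x')
      simp only [h2]
      trans (if x = x' then (c' : ℂ) else 0) * (1 / K : ℂ)
      · rw [← h3, ← hs]
        simp only [Finset.sum_mul, star_mul', Complex.star_def, Complex.conj_ofReal]
        refine Finset.sum_congr rfl fun i _ => Finset.sum_congr rfl fun k _ => ?_
        ring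
      · split_ifs <;> simp [div_eq_mul_inv]) r r'
    rw [← h1, Fintype.sum_prod_type, Finset.sum_comm]
    simp only [hmeas, Matrix.of_apply]

/-! ### LOCC protocols in which the parties are measured one after the other -/

/-- Outcomes are handled as unnormalised vectors, whereas the cost bound refers to normalised ones;
homogeneity passes between them. -/
theorem IsLOCC.map_smul {V : Type} [Fintype V] [DecidableEq V] {ι κ : V → Type}
    {C : Matrix (∀ v, ι v) (∀ v, ι v) ℂ → Matrix (∀ v, κ v) (∀ v, κ v) ℂ} (hC : IsLOCC C)
    (c : ℂ) (ρ : Matrix (∀ v, ι v) (∀ v, ι v) ℂ) : C (c • ρ) = c • C ρ := by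
  induction hC with
  | id => rfl
  | round v A hv hw next hnext ih =>
    simp only [Matrix.mul_smul, Matrix.smul_mul, ih, Finset.smul_sum]

theorem IsLOCC.map_zero {V : Type} [Fintype V] [DecidableEq V] {ι κ : V → Type}
    {C : Matrix (∀ v, ι v) (∀ v, ι v) ℂ → Matrix (∀ v, κ v) (∀ v, κ v) ℂ} (hC : IsLOCC C) :
    C 0 = 0 := by
  simpa using hC.map_smul 0 0

section Stage

variable {V : Type}

/-- The system of party `v` when only the parties `w` with `ℓ w < k` still hold their systems. -/
abbrev Stage (ℓ : V → ℕ) (X : V → Type) (k : ℕ) (v : V) : Type := ℓ v < k → X v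

variable {ℓ : V → ℕ} {X : V → Type} {k : ℕ} {v : V}

/-- Add the label of the system of the party `v` with `ℓ v = k`. -/
def Stage.snoc (hv : ∀ w, ℓ w = k → v = w) (y : ∀ w, Stage ℓ X k w) (a : X v) :
    ∀ w, Stage ℓ X (k + 1) w :=
  fun w h => if h' : ℓ w < k then y w h' else hv w (by omega) ▸ a

theorem Stage.snoc_of_lt (hv : ∀ w, ℓ w = k → v = w) (y : ∀ w, Stage ℓ X k w) (a : X v) (w : V)
    (h : ℓ w < k + 1) (h' : ℓ w < k) : Stage.snoc hv y a w h = y w h' := dif_pos h'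

theorem Stage.snoc_self (hv : ∀ w, ℓ w = k → v = w) (hk : ℓ v = k) (y : ∀ w, Stage ℓ X k w)
    (a : X v) (h : ℓ v < k + 1) : Stage.snoc hv y a v h = a := dif_neg (by omega)

/-- The labels of a stage consist of those of the next stage and of the party measured. -/
def Stage.snocEquiv (hv : ∀ w, ℓ w = k → v = w) (hk : ℓ v = k) :
    (∀ w, Stage ℓ X k w) × X v ≃ ∀ w, Stage ℓ X (k + 1) w where
  toFun p := Stage.snoc hv p.1 p.2
  invFun x := (fun w h => x w (by omega), x v (by omega))
  left_inv := by
    rintro ⟨y, a⟩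
    refine Prod.ext (funext fun w => funext fun h => ?_) ?_
    · exact Stage.snoc_of_lt hv y a w (by omega) h
    · exact Stage.snoc_self hv hk y a (by omega)
  right_inv := by
    intro x
    funext w h
    by_cases h' : ℓ w < k
    · exact Stage.snoc_of_lt hv _ _ w h h'
    · obtain rfl := hv w (by omega)
      exact Stage.snoc_self hv hk _ _ h

variable [Fintype V] [DecidableEq V] [∀ v, Fintype (X v)] [∀ v, DecidableEq (X v)]
  {κ : V → Type}

/-- One party performs a measurement given by rank-one operators; the others do nothing. -/
theorem IsLOCC.exists_measure (hv : ∀ w, ℓ w = k → v = w) (hk : ℓ v = k)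
    {O : Type} [Fintype O] (m : O → X v → ℂ)
    (hm : ∑ o, Matrix.vecMulVec (m o) (star (m o)) = 1)
    (next : O → Matrix (∀ w, Stage ℓ X k w) (∀ w, Stage ℓ X k w) ℂ →
      Matrix (∀ w, κ w) (∀ w, κ w) ℂ) (hnext : ∀ o, IsLOCC (next o)) :
    ∃ C : Matrix (∀ w, Stage ℓ X (k + 1) w) (∀ w, Stage ℓ X (k + 1) w) ℂ →
        Matrix (∀ w, κ w) (∀ w, κ w) ℂ,
      IsLOCC C ∧ ∀ (D : ℕ) (Θ : Matrix (∀ w, Stage ℓ X (k + 1) w) (Fin D) ℂ)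
        (Θ' : O → Matrix (∀ w, Stage ℓ X k w) (Fin D) ℂ) (ρ : Matrix (Fin D) (Fin D) ℂ),
        (∀ o y l, Θ' o y l = ∑ a, star (m o a) * Θ (Stage.snoc hv y a) l) →
        C (Θ * ρ * Θᴴ) = ∑ o, next o (Θ' o * ρ * (Θ' o)ᴴ) := by
  -- Party `v` applies `⟨m o|` and is left with a one-dimensional system, since `ℓ v < k` is false;
  -- for every other party `ℓ w < k` and `ℓ w < k + 1` are equivalent, and it only relabels.
  let A : ∀ (o : O) w, Matrix (Stage ℓ X k w) (Stage ℓ X (k + 1) w) ℂ := fun o w y x =>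
    if h : w = v then star (m o (h ▸ x (by rw [h]; omega)))
    else if y = fun h' => x (by omega) then 1 else 0
  have hA : ∀ o y x, A o v y x = star (m o (x (by omega))) := fun o y x => dif_pos rfl
  have hA' : ∀ o w, w ≠ v → ∀ y x, A o w y x = if y = fun h' => x (by omega) then 1 else 0 :=
    fun o w hw y x => dif_neg hw
  refine ⟨_, IsLOCC.round v A ?_ ?_ next hnext, ?_⟩
  · ext x x'
    have h1 := congrFun (congrFun hm (x (by omega))) (x' (by omega))
    rw [Matrix.sum_apply] at h1 ⊢
    have : Unique (Stage ℓ X k v) := ⟨⟨fun h => absurd h (by omega)⟩, fun y =>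
      funext fun h => absurd h (by omega)⟩
    have h2 : ∀ o, ((A o v)ᴴ * A o v) x x' =
        Matrix.vecMulVec (m o) (star (m o)) (x (by omega)) (x' (by omega)) := by
      intro o
      rw [Matrix.mul_apply, Fintype.sum_unique, Matrix.conjTranspose_apply, hA, hA, star_star]
      rfl
    rw [Finset.sum_congr rfl fun o _ => h2 o, h1, Matrix.one_apply, Matrix.one_apply]
    refine if_congr ⟨fun h => funext fun _ => h, fun h => by rw [h]⟩ rfl rfl
  · intro o w hw
    ext x x'
    simp only [Matrix.mul_apply, Matrix.conjTranspose_apply, hA' o w hw, Matrix.one_apply]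
    rw [Finset.sum_eq_single fun h' => x (by omega)]
    · simp only [if_true, star_one, one_mul]
      refine if_congr ⟨fun h => funext fun h' => ?_, fun h => by rw [h]⟩ rfl rfl
      have hne : ℓ w ≠ k := fun h'' => hw (hv w h'').symm
      exact congrFun h (by omega)
    · intro y _ hy
      simp [hy]
    · simp
  · intro D Θ Θ' ρ hΘ
    have h1 : ∀ o, localOp (A o) * Θ = Θ' o := by
      intro o
      ext y l
      rw [Matrix.mul_apply, hΘ, ← Equiv.sum_comp (Stage.snocEquiv hv hk), Fintype.sum_prod_type,
        Finset.sum_eq_single y]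
      · refine Finset.sum_congr rfl fun a _ => ?_
        congr 1
        simp only [localOp]
        rw [Finset.prod_eq_single v]
        · rw [hA]
          congr 2
          exact Stage.snoc_self hv hk y a (by omega)
        · intro w _ hw
          rw [hA' o w hw, if_pos]
          funext h'
          exact (Stage.snoc_of_lt hv y a w (by omega) h').symm
        · simp
      · intro y' _ hy'
        refine Finset.sum_eq_zero fun a _ => ?_
        obtain ⟨w, hw⟩ := Function.ne_iff.1 hy'
        obtain ⟨h', hw'⟩ := Function.ne_iff.1 hw
        have hwv : w ≠ v := by
          rintro rfl
          omega
        rw [localOp, Finset.prod_eq_zero (Finset.mem_univ w), zero_mul]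
        rw [hA' o w hwv, if_neg]
        intro h
        apply hw'
        rw [h]
        exact (Stage.snoc_of_lt hv y' a w (by omega) h').symm
      · simp
    refine Finset.sum_congr rfl fun o _ => ?_
    congr 1
    rw [← h1, Matrix.conjTranspose_mul]
    simp only [Matrix.mul_assoc]

/-- The last party holding a system decodes. -/
theorem IsLOCC.exists_decode {r : V} (hr : ∀ w, ℓ w = 0 ↔ w = r) {D : ℕ} (hD : 0 < D)
    (Θ : Matrix (∀ w, Stage ℓ X 1 w) (Fin D) ℂ) (c : ℝ) (hc : 0 ≤ c)
    (hΘ : Θᴴ * Θ = (c : ℂ) • (1 : Matrix (Fin D) (Fin D) ℂ)) :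
    ∃ C : Matrix (∀ w, Stage ℓ X 1 w) (∀ w, Stage ℓ X 1 w) ℂ →
        Matrix (∀ v, FinalSystem r D v) (∀ v, FinalSystem r D v) ℂ,
      IsLOCC C ∧ ∀ ρ : Matrix (Fin D) (Fin D) ℂ,
        C (Θ * ρ * Θᴴ) = (c : ℂ) • finalState r ρ := by
  have hr0 : ℓ r < 1 := by
    have := (hr r).2 rfl
    omega
  have hr1 : ∀ w, w ≠ r → ¬ ℓ w < 1 := fun w hw h => hw ((hr w).1 (by omega))
  let ext' : X r → ∀ w, Stage ℓ X 1 w := fun a w h =>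
    ((hr w).1 (by omega)).symm ▸ a
  let E : X r ≃ ∀ w, Stage ℓ X 1 w :=
    { toFun := ext'
      invFun := fun x => x r hr0
      left_inv := fun a => rfl
      right_inv := fun x => by
        funext w h
        obtain rfl := (hr w).1 (by omega)
        rfl }
  let Y : Matrix (X r) (Fin D) ℂ := Θ.submatrix E _root_.id
  have hY : Yᴴ * Y = (c : ℂ) • (1 : Matrix (Fin D) (Fin D) ℂ) := by
    rw [← hΘ]
    exact Matrix.submatrix_mul_equiv Θᴴ Θ _root_.id E _root_.id
  -- The projection onto the range of `Y`. If `c = 0`, the inverse is 0 by convention and `hY`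
  -- forces `Y = 0`, so the identities below persist.
  let P : Matrix (X r) (X r) ℂ := (c : ℂ)⁻¹ • (Y * Yᴴ)
  have hPH : Pᴴ = P := by
    simp [P, Matrix.conjTranspose_smul]
  have hPP : P * P = P := by
    simp only [P, Matrix.smul_mul, Matrix.mul_smul]
    rw [Matrix.mul_assoc, ← Matrix.mul_assoc Yᴴ, hY]
    simp only [Matrix.smul_mul, Matrix.one_mul, Matrix.mul_smul, smul_smul]
    congr 1
    by_cases h : (c : ℂ) = 0
    · simp [h]
    · field_simp
  have hPY : (1 - P) * Y = 0 := by
    by_cases h : (c : ℂ) = 0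
    · rw [h, zero_smul, Matrix.conjTranspose_mul_self_eq_zero] at hY
      rw [hY, Matrix.mul_zero]
    · rw [Matrix.sub_mul, Matrix.one_mul, sub_eq_zero]
      simp only [P, Matrix.smul_mul]
      rw [Matrix.mul_assoc, hY, Matrix.mul_smul, Matrix.mul_one, smul_smul, inv_mul_cancel₀ h,
        one_smul]
  let s : ℂ := ((Real.sqrt c : ℝ) : ℂ)
  have hs : s * s = c := by
    simp only [s]
    rw [← Complex.ofReal_mul, Real.mul_self_sqrt hc]
  have hstar : star s = s := by simp [s]
  -- Outcome `none` inverts the isometry `Y / √c`; the operators `|0⟩⟨a|(1 - P)` complete the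
  -- instrument and annihilate `Y`.
  let B : Option (X r) → Matrix (Fin D) (X r) ℂ := fun o => o.elim (s⁻¹ • Yᴴ)
    fun a => Matrix.of fun l x => if l = ⟨0, hD⟩ then (1 - P) a x else 0
  have hB : ∑ o, (B o)ᴴ * B o = 1 := by
    rw [Fintype.sum_option]
    have h1 : (B none)ᴴ * B none = P := by
      simp only [B, Option.elim, Matrix.conjTranspose_smul, Matrix.conjTranspose_conjTranspose,
        Matrix.smul_mul, Matrix.mul_smul, smul_smul, P, star_inv₀, hstar, ← mul_inv, hs]
    have h2 : ∑ a, (B (some a))ᴴ * B (some a) = (1 - P)ᴴ * (1 - P) := by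
      ext x x'
      rw [Matrix.sum_apply, Matrix.mul_apply]
      refine Finset.sum_congr rfl fun a _ => ?_
      rw [Matrix.mul_apply, Finset.sum_eq_single ⟨0, hD⟩]
      · simp [B]
      · intro l _ hl
        simp [B, hl]
      · simp
    rw [h1, h2, Matrix.conjTranspose_sub, hPH, Matrix.conjTranspose_one, Matrix.mul_sub,
      Matrix.sub_mul, Matrix.sub_mul, hPP]
    simp
  let A : ∀ (o : Option (X r)) w, Matrix (FinalSystem r D w) (Stage ℓ X 1 w) ℂ := fun o w y x =>
    if h : w = r then B o (y h) (h ▸ x (by rw [h]; exact hr0)) else 1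
  have hA : ∀ o y x, A o r y x = B o (y rfl) (x hr0) := fun o y x => dif_pos rfl
  have hA' : ∀ o w, w ≠ r → ∀ y x, A o w y x = 1 := fun o w hw y x => dif_neg hw
  let F : Fin D ≃ ∀ w, FinalSystem r D w :=
    { toFun := fun l _ _ => l
      invFun := fun y => y r rfl
      left_inv := fun _ => rfl
      right_inv := fun y => by
        funext w h
        subst h
        rfl }
  have hloc : ∀ o, localOp (A o) * Θ = (B o * Y).submatrix F.symm _root_.id := by
    intro o
    ext y l
    rw [Matrix.mul_apply, Matrix.submatrix_apply, Matrix.mul_apply, ← Equiv.sum_comp E]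
    refine Finset.sum_congr rfl fun a _ => ?_
    congr 1
    simp only [localOp]
    rw [Finset.prod_eq_single r, hA]
    · rfl
    · intro w _ hw
      exact hA' o w hw _ _
    · simp
  refine ⟨_, IsLOCC.round r A ?_ ?_ (fun _ ρ => ρ) fun _ => IsLOCC.id, ?_⟩
  · let F₀ : Fin D ≃ FinalSystem r D r := ⟨fun l _ => l, fun y => y rfl, fun _ => rfl, fun _ => rfl⟩
    ext x x'
    have h1 := congrFun (congrFun hB (x hr0)) (x' hr0)
    rw [Matrix.sum_apply] at h1 ⊢
    have h2 : ∀ o, ((A o r)ᴴ * A o r) x x' = ((B o)ᴴ * B o) (x hr0) (x' hr0) := by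
      intro o
      rw [Matrix.mul_apply, Matrix.mul_apply, ← Equiv.sum_comp F₀]
      refine Finset.sum_congr rfl fun l _ => ?_
      rw [Matrix.conjTranspose_apply, Matrix.conjTranspose_apply, hA, hA]
      rfl
    rw [Finset.sum_congr rfl fun o _ => h2 o, h1, Matrix.one_apply, Matrix.one_apply]
    exact if_congr ⟨fun h => funext fun _ => h, fun h => by rw [h]⟩ rfl rfl
  · intro o w hw
    ext x x'
    obtain rfl : x = x' := funext fun h => absurd h (hr1 w hw)
    have : Unique (FinalSystem r D w) := ⟨⟨fun h => absurd h hw⟩, fun y =>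
      funext fun h => absurd h hw⟩
    simp [Matrix.mul_apply, hA' o w hw]
  · intro ρ
    have h3 : ∀ o, localOp (A o) * (Θ * ρ * Θᴴ) * (localOp (A o))ᴴ =
        (B o * Y * ρ * (B o * Y)ᴴ).submatrix F.symm F.symm := by
      intro o
      have h4 : localOp (A o) * (Θ * ρ * Θᴴ) * (localOp (A o))ᴴ =
          (localOp (A o) * Θ) * ρ * (localOp (A o) * Θ)ᴴ := by
        rw [Matrix.conjTranspose_mul]
        simp only [Matrix.mul_assoc]
      rw [h4, hloc]
      ext y y'
      simp [Matrix.mul_apply]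
    simp only [h3]
    rw [Fintype.sum_option, Finset.sum_eq_zero, add_zero]
    · have h5 : B none * Y = s • (1 : Matrix (Fin D) (Fin D) ℂ) := by
        simp only [B, Option.elim, Matrix.smul_mul, hY, smul_smul, ← hs]
        congr 1
        by_cases h : s = 0
        · simp [h]
        · field_simp
      rw [h5, Matrix.conjTranspose_smul, hstar, ← hs]
      ext y y'
      simp [finalState, F, mul_assoc]
    · intro a _
      have h6 : B (some a) * Y = 0 := by
        ext l l'
        have h7 := congrFun (congrFun hPY a) l'
        rw [Matrix.mul_apply] at h7 ⊢
        by_cases hl : l = ⟨0, hD⟩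
        · simpa [B, hl] using h7
        · simp [B, hl]
      rw [h6]
      ext y y'
      simp

/-- There is some LOCC map from each stage to the final systems. -/
theorem IsLOCC.exists_of_stage {r : V} (hr : ∀ w, ℓ w = 0 ↔ w = r) {D : ℕ} (hD : 0 < D) {n : ℕ}
    (hℓ : ∀ k < n, ∃ v, ℓ v = k) (hinj : ∀ v w, ℓ v = ℓ w → v = w) (k : ℕ) (hk : k + 1 ≤ n) :
    ∃ C : Matrix (∀ w, Stage ℓ X (k + 1) w) (∀ w, Stage ℓ X (k + 1) w) ℂ →
        Matrix (∀ v, FinalSystem r D v) (∀ v, FinalSystem r D v) ℂ, IsLOCC C := by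
  induction k with
  | zero =>
    -- What is decoded is irrelevant here, so the zero matrix with `c = 0` serves.
    obtain ⟨C, hC, -⟩ := IsLOCC.exists_decode (X := X) hr hD 0 0 le_rfl (by simp)
    exact ⟨C, hC⟩
  | succ k ih =>
    obtain ⟨C, hC⟩ := ih (by omega)
    obtain ⟨v, hv⟩ := hℓ (k + 1) (by omega)
    obtain ⟨C', hC', -⟩ := IsLOCC.exists_measure (X := X)
      (fun w hw => hinj v w (hv.trans hw.symm)) hv (fun o : X v => Pi.single o 1) (by
        ext x x'
        rw [Matrix.sum_apply, Finset.sum_eq_single x]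
        · simp [Matrix.vecMulVec_apply, Matrix.one_apply, Pi.single_apply, eq_comm]
        · intro o _ ho
          simp [Matrix.vecMulVec_apply, Pi.single_apply, ho.symm]
        · simp) (fun _ => C) fun _ => hC
    exact ⟨C', hC'⟩

/-- LOCC maps on the stage in which all parties hold their systems are LOCC maps on the joint
system. -/
theorem IsLOCC.exists_of_full_stage (r : V) {n : ℕ} (hn : ∀ w, ℓ w < n)
    {C : Matrix (∀ w, Stage ℓ X n w) (∀ w, Stage ℓ X n w) ℂ → Matrix (∀ w, κ w) (∀ w, κ w) ℂ}
    (hC : IsLOCC C) :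
    ∃ C' : Matrix (∀ w, X w) (∀ w, X w) ℂ → Matrix (∀ w, κ w) (∀ w, κ w) ℂ,
      IsLOCC C' ∧ ∀ ρ, C' ρ = C (ρ.submatrix (fun y w => y w (hn w)) fun y w => y w (hn w)) := by
  let A : ∀ (_ : Unit) w, Matrix (Stage ℓ X n w) (X w) ℂ := fun _ w => Matrix.of fun y x =>
    if y (hn w) = x then 1 else 0
  have hA : ∀ o w, (A o w)ᴴ * A o w = 1 := by
    intro o w
    ext x x'
    rw [Matrix.mul_apply, Finset.sum_eq_single fun _ => x]
    · simp [A, Matrix.one_apply]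
    · intro y _ hy
      have : y (hn w) ≠ x := fun h => hy (funext fun _ => h)
      simp [A, this]
    · simp
  refine ⟨_, IsLOCC.round r A (by simp [hA]) (fun o w _ => hA o w) (fun _ => C) fun _ => hC, ?_⟩
  intro ρ
  rw [Fintype.sum_unique]
  congr 1
  have h1 : localOp (A default) = Matrix.submatrix 1 (fun y w => y w (hn w)) _root_.id := by
    ext y x
    simp only [localOp, A, Matrix.of_apply, Matrix.submatrix_apply, Matrix.one_apply, Finset.prod_ite_zero,
      Finset.prod_const_one]
    exact if_congr ⟨fun h => funext fun w => h w (Finset.mem_univ w),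
      fun h w _ => congrFun h w⟩ rfl rfl
  rw [h1]
  ext y y'
  simp [Matrix.mul_apply, Matrix.one_apply]

end Stage

/-! ### Gram matrices of measured states -/

theorem sum_star_maxEnt_mul {K : ℕ} (hK : 0 < K) :
    ∑ i : Fin K, ∑ j : Fin K, star (maxEnt K i j) * maxEnt K i j = 1 := by
  have hs : ((1 / Real.sqrt K : ℝ) : ℂ) * ((1 / Real.sqrt K : ℝ) : ℂ) = 1 / K := by
    rw [← Complex.ofReal_mul, div_mul_div_comm, Real.mul_self_sqrt (Nat.cast_nonneg K)]
    simp
  have h : ∀ i : Fin K, ∑ j : Fin K, star (maxEnt K i j) * maxEnt K i j = 1 / K := by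
    intro i
    rw [Finset.sum_eq_single i (fun j _ hj => by simp [maxEnt, hj.symm]) (by simp)]
    rw [maxEnt, if_pos rfl, Complex.star_def, Complex.conj_ofReal, hs]
  have hK' : (K : ℂ) ≠ 0 := by exact_mod_cast hK.ne'
  simp only [h, Finset.sum_const, Finset.card_univ, Fintype.card_fin, nsmul_eq_mul]
  field_simp

/-- Rank-one measurements preserve the sum of the Gram matrices. -/
theorem sum_gram_measured {R A B O : Type} [Fintype A] [Fintype B] [Fintype O]
    {K : ℕ} (hK : 0 < K) (ψ : R → A → B → ℂ) (m : O → A × Fin K → ℂ)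
    (hm : ∀ z, ∑ o, m o z * star (m o z) = 1)
    (hm' : ∀ z z', z ≠ z' → ∑ o, m o z * star (m o z') = 0) (r r' : R) :
    ∑ o, ∑ y, star (measured ψ (m o) r y) * measured ψ (m o) r' y =
      ∑ a, ∑ b, star (ψ r a b) * ψ r' a b := by
  classical
  have h1 : ∀ r o y, measured ψ (m o) r y =
      ∑ z : A × Fin K, star (m o z) * (ψ r z.1 y.1 * maxEnt K z.2 y.2) := by
    intro r o y
    rw [Fintype.sum_prod_type]
    rfl
  have h2 : ∀ z z', ∑ o, m o z * star (m o z') = if z = z' then 1 else 0 := by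
    intro z z'
    split_ifs with h
    · rw [← h, hm]
    · exact hm' z z' h
  have h3 : ∀ y : B × Fin K, ∑ o, star (measured ψ (m o) r y) * measured ψ (m o) r' y =
      ∑ z : A × Fin K, star (ψ r z.1 y.1 * maxEnt K z.2 y.2) *
        (ψ r' z.1 y.1 * maxEnt K z.2 y.2) := by
    intro y
    calc ∑ o, star (measured ψ (m o) r y) * measured ψ (m o) r' y
        = ∑ o, ∑ z, ∑ z', (star (ψ r z.1 y.1 * maxEnt K z.2 y.2) *
            (ψ r' z'.1 y.1 * maxEnt K z'.2 y.2)) * (m o z * star (m o z')) := by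
          refine Finset.sum_congr rfl fun o _ => ?_
          rw [h1, h1, star_sum, Finset.sum_mul_sum]
          refine Finset.sum_congr rfl fun z _ => Finset.sum_congr rfl fun z' _ => ?_
          rw [star_mul', star_star]
          ring
      _ = ∑ z, ∑ z', (star (ψ r z.1 y.1 * maxEnt K z.2 y.2) *
            (ψ r' z'.1 y.1 * maxEnt K z'.2 y.2)) * ∑ o, (m o z * star (m o z')) := by
          rw [Finset.sum_comm]
          refine Finset.sum_congr rfl fun z _ => ?_
          rw [Finset.sum_comm]
          refine Finset.sum_congr rfl fun z' _ => ?_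
          rw [Finset.mul_sum]
      _ = _ := by
          simp only [h2, mul_ite, mul_one, mul_zero, Finset.sum_ite_eq, Finset.mem_univ, if_true]
  rw [Finset.sum_comm, Finset.sum_congr rfl fun y _ => h3 y]
  calc ∑ y : B × Fin K, ∑ z : A × Fin K, star (ψ r z.1 y.1 * maxEnt K z.2 y.2) *
        (ψ r' z.1 y.1 * maxEnt K z.2 y.2)
      = ∑ a, ∑ b, (star (ψ r a b) * ψ r' a b) *
          ∑ i : Fin K, ∑ j : Fin K, star (maxEnt K i j) * maxEnt K i j := by
        rw [Finset.sum_comm, Fintype.sum_prod_type]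
        refine Finset.sum_congr rfl fun a _ => ?_
        simp only [Fintype.sum_prod_type]
        rw [Finset.sum_comm]
        refine Finset.sum_congr rfl fun b _ => ?_
        rw [Finset.mul_sum]
        refine Finset.sum_congr rfl fun i _ => ?_
        rw [Finset.mul_sum]
        refine Finset.sum_congr rfl fun j _ => ?_
        rw [star_mul']
        ring
    _ = _ := by simp only [sum_star_maxEnt_mul hK, mul_one]

/-- The entrywise form avoids the identity matrix, and with it any choice of decidable equality. -/
theorem IsExactMerging.sum_mul_star {R A B : Type} [Fintype A] [Fintype B] {K n : ℕ}
    {ψ : R → A → B → ℂ} {m : Fin n → A × Fin K → ℂ} (h : IsExactMerging ψ m) :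
    (∀ z, ∑ o, m o z * star (m o z) = 1) ∧
      ∀ z z', z ≠ z' → ∑ o, m o z * star (m o z') = 0 := by
  have h1 : ∀ z z', ∑ o, m o z * star (m o z') =
      (∑ o, Matrix.vecMulVec (m o) (star (m o))) z z' := fun z z' => by
    rw [Matrix.sum_apply]
    rfl
  classical
  refine ⟨fun z => ?_, fun z z' hz => ?_⟩
  · rw [h1, h.1, Matrix.one_apply_eq]
  · rw [h1, h.1, Matrix.one_apply_ne hz]

/-- Exact state merging leaves the reduced state of the reference unchanged. -/
theorem IsExactMerging.exists_gram_measured {R A B : Type} [Fintype A] [Fintype B] {K n : ℕ}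
    {ψ : R → A → B → ℂ} {m : Fin n → A × Fin K → ℂ} (h : IsExactMerging ψ m) (o : Fin n) :
    ∃ t : ℝ, 0 ≤ t ∧ ∀ r r', ∑ y, star (measured ψ (m o) r y) * measured ψ (m o) r' y =
      t * ∑ a, ∑ b, star (ψ r a b) * ψ r' a b := by
  classical
  obtain ⟨d, W, χ, hW, hWχ⟩ := h.2 o
  -- The isometry preserves the Gram matrix of the measured state, and on `ψ ⊗ χ` the auxiliary
  -- vector contributes only `‖χ‖²`.
  refine ⟨∑ i, ‖χ i‖ ^ 2, Finset.sum_nonneg fun i _ => by positivity, fun r r' => ?_⟩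
  have h1 : ∀ r z, (W *ᵥ measured ψ (m o) r) z = χ z.2 * ψ r z.1.1 z.1.2 := fun r z =>
    hWχ r z.1.1 z.1.2 z.2
  have hW' : Wᴴ * W = 1 := by convert hW
  have h2 : star (W *ᵥ measured ψ (m o) r) ⬝ᵥ (W *ᵥ measured ψ (m o) r') =
      star (measured ψ (m o) r) ⬝ᵥ measured ψ (m o) r' := by
    rw [Matrix.star_mulVec, ← Matrix.dotProduct_mulVec, Matrix.mulVec_mulVec, hW',
      Matrix.one_mulVec]
  refine h2.symm.trans ?_
  simp only [dotProduct, Pi.star_apply, h1, Fintype.sum_prod_type, Finset.mul_sum]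
  refine Finset.sum_congr rfl fun a _ => Finset.sum_congr rfl fun b _ => ?_
  push_cast
  rw [Finset.sum_mul]
  refine Finset.sum_congr rfl fun i _ => ?_
  rw [star_mul', ← Complex.mul_conj', Complex.star_def]
  ring

/-! ### Edges of a rooted tree and the systems of the parties -/

section Tree

variable {V : Type} {T : SimpleGraph V} (hT : T.IsTree) {r : V}

theorem adj_parent {c : V} (hc : c ≠ r) : T.Adj (parent hT r c) c := by
  have hn : ¬ (hT.existsUnique_path c r).choose.Nil := SimpleGraph.Walk.not_nil_of_ne hc
  exact ((hT.existsUnique_path c r).choose.adj_snd hn).symm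

/-- The edge between a vertex that is not the root and its parent. -/
def parentEdge (c : {c : V // c ≠ r}) : T.edgeSet :=
  ⟨s(parent hT r c, c), adj_parent hT c.2⟩

theorem left_mem_parentEdge (c : {c : V // c ≠ r}) : parent hT r c ∈ (parentEdge hT c).1 :=
  Sym2.mem_mk_left _ _

theorem right_mem_parentEdge (c : {c : V // c ≠ r}) : c.1 ∈ (parentEdge hT c).1 :=
  Sym2.mem_mk_right _ _

theorem mem_parentEdge {c : {c : V // c ≠ r}} {v : V} (h : v ∈ (parentEdge hT c).1) :
    parent hT r c = v ∨ c.1 = v := by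
  rcases Sym2.mem_iff.1 h with h | h
  exacts [Or.inl h.symm, Or.inr h.symm]

variable [Fintype V]

/-- If two vertices had the same parent edge with the ends exchanged, each label would be smaller
than the other. Surjectivity is by counting: a tree has one edge fewer than vertices. -/
theorem parentEdge_bijective (L : AscendingLabeling T r) :
    Function.Bijective (parentEdge (r := r) hT) := by
  classical
  rw [Fintype.bijective_iff_injective_and_card]
  constructor
  · intro c c' h
    have h' : s(parent hT r c, c.1) = s(parent hT r c', c'.1) := congrArg Subtype.val h
    rw [Sym2.eq_iff] at h'
    rcases h' with h' | h'
    · exact Subtype.ext h'.2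
    · have h1 := L.parent_lt hT c.2
      have h2 := L.parent_lt hT c'.2
      rw [h'.1] at h1
      rw [← h'.2] at h2
      exact absurd h1 h2.asymm
  · have h1 := hT.card_edgeFinset
    rw [SimpleGraph.edgeFinset_card] at h1
    rw [Fintype.card_subtype_compl, Fintype.card_subtype_eq]
    omega

/-- A dependent function can be prescribed after composition with a bijection. -/
theorem exists_eq_of_bijective {I J : Type} {Z : J → Type} {σ : I → J}
    (hσ : Function.Bijective σ) (g : ∀ i, Z (σ i)) : ∃ f : ∀ j, Z j, ∀ i, f (σ i) = g i :=
  ⟨Equiv.piCongrLeft Z (Equiv.ofBijective σ hσ) g,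
    fun i => Equiv.piCongrLeft_apply_apply Z (Equiv.ofBijective σ hσ) g i⟩

variable (L : AscendingLabeling T r)

theorem AscendingLabeling.label_eq_zero_iff (w : V) : (L.label w : ℕ) = 0 ↔ w = r := by
  constructor
  · intro h
    apply L.label.injective
    ext
    rw [h, L.label_root]
  · rintro rfl
    exact L.label_root

theorem AscendingLabeling.ne_root {c : V} {k : ℕ} (hk : 0 < k) (h : k ≤ (L.label c : ℕ)) :
    c ≠ r := by
  rintro rfl
  rw [L.label_root] at h
  omega

theorem AscendingLabeling.parent_label_lt (c : {c : V // c ≠ r}) :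
    (L.label (parent hT r c) : ℕ) < L.label c.1 := L.parent_lt hT c.2

theorem AscendingLabeling.vertex_eq {k : ℕ} (hk : k < Fintype.card V) (w : V)
    (h : (L.label w : ℕ) = k) : L.vertex k hk = w := L.eq_vertex hk (by omega) (by omega)

variable (M : Sym2 V → ℕ) {ι : V → Type} {D : ℕ}

/-- The labels of the systems and initial resources of the parties that have not been measured
yet. -/
abbrev InitialStage (M : Sym2 V → ℕ) (ι : V → Type) (k : ℕ) (w : V) : Type :=
  Stage (fun w => (L.label w : ℕ)) (InitialSystem T M ι) k w

/-- The labels of the joint state at stage `k`: those of all systems except the halves of the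
resource states reserved for the remaining mergings. -/
def held (k : ℕ) (hk : 0 < k) (x : ∀ w, InitialStage L M ι k w) : JointSystem hT L M ι k :=
  fun w hw => ((x w hw).1, fun c hc hle =>
    (x w hw).2 (parentEdge hT ⟨c, L.ne_root hk hle⟩) (hc ▸ left_mem_parentEdge hT _))

/-- The amplitude of the resource state of the edge from `c` to its parent, if `c` has not been
measured yet. -/
def edgeAmp (k : ℕ) (x : ∀ w, InitialStage L M ι k w) (c : {c : V // c ≠ r}) : ℂ :=
  if h : (L.label c.1 : ℕ) < k then
    maxEnt (M s(parent hT r c, c))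
      ((x c h).2 (parentEdge hT c) (right_mem_parentEdge hT c))
      ((x (parent hT r c) ((L.parent_label_lt hT c).trans h)).2 (parentEdge hT c)
        (left_mem_parentEdge hT c))
  else 1

/-- The joint state of the parties that have not been measured yet: the state `ψ` together with
the resource states not used so far. -/
def stageState [DecidableEq V] (k : ℕ) (hk : 0 < k) (ψ : Fin D → JointSystem hT L M ι k → ℂ) :
    Matrix (∀ w, InitialStage L M ι k w) (Fin D) ℂ :=
  Matrix.of fun x l => ψ l (held hT L M k hk x) * ∏ c, edgeAmp hT L M k x c

/-- The systems of the party to be measured: its part of the joint state and its half of the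
resource state shared with its parent. -/
def splitHalf (k : ℕ) (hk : k + 1 < Fintype.card V)
    (a : InitialSystem T M ι (L.vertex (k + 1) hk)) :
    HeldSystem hT L M ι (k + 2) (L.vertex (k + 1) hk) ×
      Fin (M s(parent hT r (L.vertex (k + 1) hk), L.vertex (k + 1) hk)) :=
  ((a.1, fun c hc hle => a.2 (parentEdge hT ⟨c, L.ne_root (Nat.succ_pos _) hle⟩)
      (hc ▸ left_mem_parentEdge hT _)),
    a.2 (parentEdge hT ⟨_, L.ne_root (Nat.succ_pos k) (L.label_vertex _ hk).ge⟩)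
      (right_mem_parentEdge hT _))

/-- Every edge at the vertex leads to its parent or to a child, and children carry larger labels, so
they have already been measured and their halves belong to the joint state. -/
theorem splitHalf_bijective (k : ℕ) (hk : k + 1 < Fintype.card V) :
    Function.Bijective (splitHalf hT L M (ι := ι) k hk) := by
  classical
  have hv := L.label_vertex (k + 1) hk
  constructor
  · intro a a' h
    have h1 : a.1 = a'.1 := congrArg (fun p => p.1.1) h
    have h2 : (splitHalf hT L M k hk a).1.2 = (splitHalf hT L M k hk a').1.2 :=
      congrArg (fun p => p.1.2) h
    have h3 : (splitHalf hT L M k hk a).2 = (splitHalf hT L M k hk a').2 :=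
      congrArg (fun p => p.2) h
    refine Prod.ext h1 (funext fun e => funext fun he => ?_)
    obtain ⟨c, rfl⟩ := (parentEdge_bijective hT L).2 e
    rcases mem_parentEdge hT he with hc | hc
    · have hlt := L.parent_label_lt hT c
      rw [hc, hv] at hlt
      exact congrFun (congrFun (congrFun h2 c.1) hc) hlt
    · obtain ⟨c, hcr⟩ := c
      subst hc
      exact h3
  · rintro ⟨⟨p, g⟩, i⟩
    have hlt : ∀ c : {c : V // c ≠ r}, parent hT r c = L.vertex (k + 1) hk →
        k + 2 ≤ (L.label c.1 : ℕ) := by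
      intro c hc
      have hlt := L.parent_label_lt hT c
      rw [hc, hv] at hlt
      exact hlt
    obtain ⟨f, hf⟩ := exists_eq_of_bijective
      (Z := fun e : T.edgeSet => L.vertex (k + 1) hk ∈ e.1 → Fin (M e.1))
      (parentEdge_bijective hT L) fun c hc =>
        if h : parent hT r c = L.vertex (k + 1) hk then g c.1 h (hlt c h)
        else Eq.rec (motive := fun w _ => Fin (M s(parent hT r w, w))) i
          ((mem_parentEdge hT hc).resolve_left h).symm
    refine ⟨(p, f), Prod.ext (Prod.ext rfl ?_) ?_⟩
    · funext c hc hle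
      exact (congrFun (hf ⟨c, L.ne_root (Nat.succ_pos _) hle⟩) _).trans (dif_pos hc)
    · refine (congrFun (hf ⟨_, L.ne_root (Nat.succ_pos k) hv.ge⟩) _).trans ((dif_neg ?_).trans rfl)
      intro h
      have := L.parent_lt hT (L.ne_root (Nat.succ_pos k) hv.ge)
      rw [h] at this
      exact lt_irrefl _ this

/-- After the last party has been absorbed, the joint system consists of the systems that the
other parties held before and of the parent's half of a resource state. -/
theorem absorb_bijective (k : ℕ) (hk : k + 1 < Fintype.card V) :
    Function.Bijective fun x : JointSystem hT L M ι (k + 1) =>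
      (((fun w hw => ((x w hw).1, fun c hc hle => (x w hw).2 c hc (Nat.le_of_succ_le hle)) :
          RestSystem hT L M ι (k + 1)),
        (x _ (L.label_parent_vertex hT k hk)).2 (L.vertex (k + 1) hk) rfl
          (L.label_vertex (k + 1) hk).ge) :
        RestSystem hT L M ι (k + 1) ×
          Fin (M s(parent hT r (L.vertex (k + 1) hk), L.vertex (k + 1) hk))) := by
  have hv := L.label_vertex (k + 1) hk
  constructor
  · intro x x' h
    simp only [Prod.mk.injEq] at h
    obtain ⟨h1, h2⟩ := h
    funext w hw
    have h3 := congrFun (congrFun h1 w) hw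
    simp only [Prod.mk.injEq] at h3
    refine Prod.ext h3.1 (funext fun c => funext fun hc => funext fun hle => ?_)
    -- The only child newly counted at this stage is the vertex just measured, whose half is the
    -- second component.
    by_cases h4 : k + 1 + 1 ≤ (L.label c : ℕ)
    · exact congrFun (congrFun (congrFun h3.2 c) hc) h4
    · obtain rfl := L.vertex_eq hk c (by omega)
      subst hc
      exact h2
  · rintro ⟨b, i⟩
    refine ⟨fun w hw => ((b w hw).1, fun c hc hle =>
      if h : k + 1 + 1 ≤ (L.label c : ℕ) then (b w hw).2 c hc h
      else L.vertex_eq hk c (by omega) ▸ i), ?_⟩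
    simp only [Prod.mk.injEq]
    constructor
    · funext w hw
      refine Prod.ext rfl (funext fun c => funext fun hc => funext fun hle => ?_)
      exact dif_pos hle
    · exact dif_neg (by omega)

/-- Only the root is left, and all its edges lead to children, so no resource half is still
reserved. -/
theorem held_one_bijective :
    Function.Bijective (held hT L M (ι := ι) 1 Nat.one_pos) := by
  have hr : ∀ w, (L.label w : ℕ) < 1 → w = r := fun w hw =>
    (L.label_eq_zero_iff w).1 (by omega)
  have hpar : ∀ w, (L.label w : ℕ) < 1 → ∀ c : {c : V // c ≠ r}, w ∈ (parentEdge hT c).1 →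
      parent hT r c = w := fun w hw c hc =>
    (mem_parentEdge hT hc).resolve_right fun h => c.2 (h.trans (hr w hw))
  have hpos : ∀ c : {c : V // c ≠ r}, 1 ≤ (L.label c.1 : ℕ) := fun c =>
    Nat.one_le_iff_ne_zero.2 fun h => c.2 ((L.label_eq_zero_iff c.1).1 h)
  constructor
  · intro x x' h
    funext w hw
    have h1 := congrFun (congrFun h w) hw
    have h2 : (held hT L M 1 Nat.one_pos x w hw).2 = (held hT L M 1 Nat.one_pos x' w hw).2 :=
      congrArg (fun p => p.2) h1
    refine Prod.ext (congrArg (fun p => p.1) h1) (funext fun e => funext fun he => ?_)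
    obtain ⟨c, rfl⟩ := (parentEdge_bijective hT L).2 e
    exact congrFun (congrFun (congrFun h2 c.1) (hpar w hw c he)) (hpos c)
  · intro j
    choose f hf using fun w (hw : (L.label w : ℕ) < 1) => exists_eq_of_bijective
      (Z := fun e : T.edgeSet => w ∈ e.1 → Fin (M e.1))
      (parentEdge_bijective hT L) fun c hc => (j w hw).2 c.1 (hpar w hw c hc) (hpos c)
    refine ⟨fun w hw => ((j w hw).1, f w hw), ?_⟩
    funext w hw
    refine Prod.ext rfl (funext fun c => funext fun hc => funext fun hle => ?_)
    exact congrFun (hf w hw ⟨c, L.ne_root Nat.one_pos hle⟩) _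

/-- No label reaches `card V`, so at the outset no resource half counts as part of the joint state.
-/
theorem joint_fst_bijective :
    Function.Bijective fun (x : JointSystem hT L M ι (Fintype.card V)) v =>
      (x v (L.label v).isLt).1 := by
  constructor
  · intro x x' h
    funext w hw
    refine Prod.ext (congrFun h w) (funext fun c => funext fun _ => funext fun hle => ?_)
    exact absurd (L.label c).isLt (by omega)
  · intro y
    exact ⟨fun w _ => (y w, fun c _ hle => absurd (L.label c).isLt (by omega)), rfl⟩

end Tree

/-! ### Sequential merging -/

section Tree

variable {V : Type} [Fintype V] {T : SimpleGraph V} (hT : T.IsTree) {r : V}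
  (L : AscendingLabeling T r) (M : Sym2 V → ℕ) {ι : V → Type} {D : ℕ}

theorem edgeAmp_one (x : ∀ w, InitialStage L M ι 1 w) (c : {c : V // c ≠ r}) :
    edgeAmp hT L M 1 x c = 1 :=
  dif_neg fun h => c.2 ((L.label_eq_zero_iff c.1).1 (by omega))

/-- This brings the joint system into the form that `splitLast` takes apart: the measured party's
share and the others' systems without the half about to be absorbed. -/
theorem held_snoc (k : ℕ) (hk : k + 1 < Fintype.card V)
    (y : ∀ w, InitialStage L M ι (k + 1) w) (a : InitialSystem T M ι (L.vertex (k + 1) hk)) :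
    held hT L M (k + 2) (Nat.succ_pos _) (Stage.snoc (L.vertex_eq hk) y a) =
      Stage.snoc (ℓ := fun w => (L.label w : ℕ)) (X := HeldSystem hT L M ι (k + 2))
        (L.vertex_eq hk)
        (fun w hw => ((held hT L M (k + 1) (Nat.succ_pos _) y w hw).1, fun c hc hle =>
          (held hT L M (k + 1) (Nat.succ_pos _) y w hw).2 c hc (Nat.le_of_succ_le hle)))
        (splitHalf hT L M k hk a).1 := by
  have hv := L.label_vertex (k + 1) hk
  funext w hw
  by_cases h : (L.label w : ℕ) < k + 1
  · rw [Stage.snoc_of_lt (ℓ := fun w => (L.label w : ℕ)) _ _ _ w hw h]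
    simp only [held]
    rw [Stage.snoc_of_lt (ℓ := fun w => (L.label w : ℕ)) _ _ _ w hw h]
  · obtain rfl := L.vertex_eq hk w (by omega)
    rw [Stage.snoc_self (ℓ := fun w => (L.label w : ℕ)) _ hv]
    simp only [held]
    rw [Stage.snoc_self (ℓ := fun w => (L.label w : ℕ)) _ hv]
    rfl

variable [DecidableEq V]

theorem stageState_smul (k : ℕ) (hk : 0 < k) (c : ℂ) (ψ : Fin D → JointSystem hT L M ι k → ℂ) :
    stageState hT L M k hk (c • ψ) = c • stageState hT L M k hk ψ := by
  ext x l
  simp [stageState, mul_assoc]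

/-- Measuring a vertex consumes exactly the edge to its parent; the edges to its children were
consumed before. The parent's half is read off from its enlarged system. -/
theorem prod_edgeAmp_snoc (k : ℕ) (hk : k + 1 < Fintype.card V)
    (y : ∀ w, InitialStage L M ι (k + 1) w) (a : InitialSystem T M ι (L.vertex (k + 1) hk)) :
    ∏ c, edgeAmp hT L M (k + 2) (Stage.snoc (L.vertex_eq hk) y a) c =
      maxEnt _ (splitHalf hT L M k hk a).2
        ((held hT L M (k + 1) (Nat.succ_pos _) y _ (L.label_parent_vertex hT k hk)).2
          (L.vertex (k + 1) hk) rfl (L.label_vertex (k + 1) hk).ge) *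
      ∏ c, edgeAmp hT L M (k + 1) y c := by
  have hv := L.label_vertex (k + 1) hk
  let v : {c : V // c ≠ r} := ⟨L.vertex (k + 1) hk, L.ne_root (Nat.succ_pos k) hv.ge⟩
  rw [← Finset.mul_prod_erase _ _ (Finset.mem_univ v),
    ← Finset.mul_prod_erase _ (edgeAmp hT L M (k + 1) y) (Finset.mem_univ v)]
  have h1 : edgeAmp hT L M (k + 1) y v = 1 := dif_neg (by simp only [v]; omega)
  rw [h1, one_mul]
  congr 1
  · have hlt : (L.label v.1 : ℕ) < k + 2 := by simp only [v]; omega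
    refine (dif_pos hlt).trans ?_
    have h2 := Stage.snoc_self (ℓ := fun w => (L.label w : ℕ)) (L.vertex_eq hk) hv y a hlt
    have h3 := Stage.snoc_of_lt (ℓ := fun w => (L.label w : ℕ)) (L.vertex_eq hk) y a
      (parent hT r v.1) ((L.parent_label_lt hT v).trans hlt) (L.label_parent_vertex hT k hk)
    rw [h3]
    simp only [v] at h2 ⊢
    rw [h2]
    rfl
  · refine Finset.prod_congr rfl fun c hc => ?_
    have hcv : c.1 ≠ L.vertex (k + 1) hk := fun h =>
      (Finset.mem_erase.1 hc).1 (Subtype.ext h)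
    have hck : (L.label c.1 : ℕ) ≠ k + 1 := fun h => hcv (L.vertex_eq hk c.1 h).symm
    by_cases h : (L.label c.1 : ℕ) < k + 1
    · have h' : (L.label c.1 : ℕ) < k + 2 := by omega
      have hp : (L.label (parent hT r c.1) : ℕ) < k + 1 := (L.parent_label_lt hT c).trans h
      simp only [edgeAmp, dif_pos h, dif_pos h']
      rw [Stage.snoc_of_lt (ℓ := fun w => (L.label w : ℕ)) _ _ _ c.1 h' h,
        Stage.snoc_of_lt (ℓ := fun w => (L.label w : ℕ)) _ _ _ _ (by omega) hp]
    · have h' : ¬ (L.label c.1 : ℕ) < k + 2 := by omega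
      simp only [edgeAmp, dif_neg h, dif_neg h']

variable [∀ v, Fintype (ι v)]

theorem sum_splitLast (k : ℕ) (hk : k < Fintype.card V)
    (ψ : Fin D → JointSystem hT L M ι (k + 1) → ℂ) (l l' : Fin D) :
    ∑ a, ∑ b, star (splitLast hT L M k hk ψ l a b) * splitLast hT L M k hk ψ l' a b =
      ∑ x, star (ψ l x) * ψ l' x := by
  rw [Finset.sum_comm, ← Fintype.sum_prod_type' (f := fun b a =>
    star (splitLast hT L M k hk ψ l a b) * splitLast hT L M k hk ψ l' a b)]
  exact Equiv.sum_comp (Stage.snocEquiv (ℓ := fun w => (L.label w : ℕ))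
    (X := HeldSystem hT L M ι (k + 1)) (L.vertex_eq hk) (L.label_vertex k hk))
    fun x => star (ψ l x) * ψ l' x

theorem sum_absorb (k : ℕ) (hk : k + 1 < Fintype.card V)
    (ψ : Fin D → RestSystem hT L M ι (k + 1) ×
      Fin (M s(parent hT r (L.vertex (k + 1) hk), L.vertex (k + 1) hk)) → ℂ) (l l' : Fin D) :
    ∑ x, star (absorb hT L M k hk ψ l x) * absorb hT L M k hk ψ l' x =
      ∑ y, star (ψ l y) * ψ l' y :=
  (absorb_bijective hT L M k hk).sum_comp fun y => star (ψ l y) * ψ l' y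

variable [DecidableRel T.Adj]

/-- The measurement of one party takes the joint state to that of the next stage. -/
theorem stageState_absorb_measured (k : ℕ) (hk : k + 1 < Fintype.card V)
    (ψ : Fin D → JointSystem hT L M ι (k + 2) → ℂ)
    (m : HeldSystem hT L M ι (k + 2) (L.vertex (k + 1) hk) ×
        Fin (M s(parent hT r (L.vertex (k + 1) hk), L.vertex (k + 1) hk)) → ℂ)
    (y : ∀ w, InitialStage L M ι (k + 1) w) (l : Fin D) :
    stageState hT L M (k + 1) (Nat.succ_pos _)
        (absorb hT L M k hk (measured (splitLast hT L M (k + 1) hk ψ) m)) y l =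
      ∑ a, star (m (splitHalf hT L M k hk a)) *
        stageState hT L M (k + 2) (Nat.succ_pos _) ψ (Stage.snoc (L.vertex_eq hk) y a) l := by
  have h1 : ∀ a, stageState hT L M (k + 2) (Nat.succ_pos _) ψ
      (Stage.snoc (L.vertex_eq hk) y a) l =
      splitLast hT L M (k + 1) hk ψ l (splitHalf hT L M k hk a).1
        (fun w hw => ((held hT L M (k + 1) (Nat.succ_pos _) y w hw).1, fun c hc hle =>
          (held hT L M (k + 1) (Nat.succ_pos _) y w hw).2 c hc (Nat.le_of_succ_le hle))) *
      (maxEnt _ (splitHalf hT L M k hk a).2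
        ((held hT L M (k + 1) (Nat.succ_pos _) y _ (L.label_parent_vertex hT k hk)).2
          (L.vertex (k + 1) hk) rfl (L.label_vertex (k + 1) hk).ge) *
        ∏ c, edgeAmp hT L M (k + 1) y c) := by
    intro a
    simp only [stageState, Matrix.of_apply]
    rw [prod_edgeAmp_snoc, held_snoc]
    rfl
  simp only [h1]
  -- Reindexing turns the contraction over the party's whole initial system into the double sum that
  -- defines `measured`.
  rw [(splitHalf_bijective hT L M k hk).sum_comp (fun z => star (m z) *
      (splitLast hT L M (k + 1) hk ψ l z.1
        (fun w hw => ((held hT L M (k + 1) (Nat.succ_pos _) y w hw).1, fun c hc hle =>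
          (held hT L M (k + 1) (Nat.succ_pos _) y w hw).2 c hc (Nat.le_of_succ_le hle))) *
      (maxEnt _ z.2
        ((held hT L M (k + 1) (Nat.succ_pos _) y _ (L.label_parent_vertex hT k hk)).2
          (L.vertex (k + 1) hk) rfl (L.label_vertex (k + 1) hk).ge) *
        ∏ c, edgeAmp hT L M (k + 1) y c))), Fintype.sum_prod_type]
  simp only [stageState, Matrix.of_apply, absorb, measured, Finset.sum_mul]
  refine Finset.sum_congr rfl fun p _ => Finset.sum_congr rfl fun i _ => ?_
  ring

end Tree

section Tree

variable {V : Type} [Fintype V] [DecidableEq V] {T : SimpleGraph V} [DecidableRel T.Adj]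
  (hT : T.IsTree) {r : V} (L : AscendingLabeling T r) {M : Sym2 V → ℕ} {ι : V → Type}
  {D : ℕ}

/-- The resource state is the product over the vertices other than the root of the resource
states shared with their parents. -/
theorem resourceAmp_eq_prod_edgeAmp {n : ℕ} (hn : ∀ w, (L.label w : ℕ) < n)
    (x : ∀ w, InitialStage L M ι n w) :
    resourceAmp T M (fun w => x w (hn w)) = ∏ c, edgeAmp hT L M n x c := by
  classical
  rw [resourceAmp, ← (parentEdge_bijective hT L).prod_comp]
  refine Finset.prod_congr rfl fun c _ => ?_
  rw [edgeAmp, dif_pos (hn c)]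
  have hiff : (∀ v w, ∀ (hv : v ∈ (parentEdge hT c).1) (hw : w ∈ (parentEdge hT c).1),
      (x v (hn v)).2 (parentEdge hT c) hv = (x w (hn w)).2 (parentEdge hT c) hw) ↔
      (x c (hn c)).2 (parentEdge hT c) (right_mem_parentEdge hT c) =
        (x (parent hT r c) (hn _)).2 (parentEdge hT c) (left_mem_parentEdge hT c) := by
    refine ⟨fun h => h _ _ _ _, fun h v w hv hw => ?_⟩
    rcases mem_parentEdge hT hv with h1 | h1 <;> rcases mem_parentEdge hT hw with h2 | h2 <;>
      subst h1
    · subst h2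
      rfl
    · subst h2
      exact h.symm
    · subst h2
      exact h
    · obtain rfl := h2
      rfl
  by_cases h : (x c (hn c)).2 (parentEdge hT c) (right_mem_parentEdge hT c) =
      (x (parent hT r c) (hn _)).2 (parentEdge hT c) (left_mem_parentEdge hT c)
  · exact (if_pos (hiff.2 h)).trans (if_pos h).symm
  · exact (if_neg fun h' => h (hiff.1 h')).trans (if_neg h).symm

variable [∀ v, Fintype (ι v)]

/-- Sequential merging along an ascending labeling, followed by decoding at the root. -/
theorem exists_isLOCC_of_mergingCostBound (hM : ∀ e ∈ T.edgeSet, 0 < M e) (hD : 0 < D)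
    (n : ℕ) (hn0 : 0 < n) (hn : n ≤ Fintype.card V) (ψ : Fin D → JointSystem hT L M ι n → ℂ)
    (c : ℝ) (hc : 0 ≤ c)
    (hψ : ∀ l l', ∑ x, star (ψ l x) * ψ l' x = if l = l' then (c : ℂ) else 0)
    (hb : MergingCostBound hT L M n hn ψ) :
    ∃ C : Matrix (∀ w, InitialStage L M ι n w) (∀ w, InitialStage L M ι n w) ℂ →
        Matrix (∀ v, FinalSystem r D v) (∀ v, FinalSystem r D v) ℂ,
      IsLOCC C ∧ ∀ ρ : Matrix (Fin D) (Fin D) ℂ,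
        C (stageState hT L M n hn0 ψ * ρ * (stageState hT L M n hn0 ψ)ᴴ) =
          (c : ℂ) • finalState r ρ := by
  classical
  have hr := L.label_eq_zero_iff
  induction n generalizing c with
  | zero => exact absurd hn0 (lt_irrefl 0)
  | succ n ih =>
  obtain _ | k := n
  -- At the root the joint state exhausts the system and no edge amplitudes remain, so the invariant
  -- is the hypothesis on `Θ` needed for decoding.
  · refine IsLOCC.exists_decode hr hD _ c hc ?_
    ext l l'
    have h1 : (((c : ℂ) • (1 : Matrix (Fin D) (Fin D) ℂ)) : Matrix (Fin D) (Fin D) ℂ) l l' =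
        if l = l' then (c : ℂ) else 0 := by
      simp [Matrix.one_apply]
    rw [Matrix.mul_apply, h1, ← hψ,
      ← (held_one_bijective hT L M).sum_comp fun x => star (ψ l x) * ψ l' x]
    refine Finset.sum_congr rfl fun x _ => ?_
    simp [stageState, edgeAmp_one]
  · have hv := L.label_vertex (k + 1) hn
    have hK : 0 < M s(parent hT r (L.vertex (k + 1) hn), L.vertex (k + 1) hn) :=
      hM _ (adj_parent hT (L.ne_root (Nat.succ_pos k) hv.ge))
    obtain ⟨⟨δ, hδ⟩, N, m, hm, hnext⟩ := hb
    -- The cost bound guarantees that some measurement merges, hence the prescribed one does.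
    have hex : IsExactMerging (splitLast hT L M (k + 1) hn ψ) m :=
      hm (δ.exists_isExactMerging hK hδ)
    obtain ⟨hm1, hm0⟩ := IsExactMerging.sum_mul_star hex
    choose t ht0 ht using hex.exists_gram_measured
    have hgram : ∀ o l l', ∑ y, star (measured (splitLast hT L M (k + 1) hn ψ) (m o) l y) *
        measured (splitLast hT L M (k + 1) hn ψ) (m o) l' y =
          if l = l' then ((t o * c : ℝ) : ℂ) else 0 := by
      intro o l l'
      rw [ht, sum_splitLast, hψ]
      split_ifs <;> simp
    -- The outcome probabilities sum to 1; this is read off from a diagonal entry, which exists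
    -- because `0 < D`.
    have hsum : ∑ o, t o * c = c := by
      have h1 := sum_gram_measured hK (splitLast hT L M (k + 1) hn ψ) m hm1 hm0 ⟨0, hD⟩ ⟨0, hD⟩
      rw [sum_splitLast, hψ] at h1
      simp only [hgram, if_true] at h1
      exact_mod_cast h1
    have hstep : ∀ o, ∃ C : Matrix (∀ w, InitialStage L M ι (k + 1) w)
        (∀ w, InitialStage L M ι (k + 1) w) ℂ →
          Matrix (∀ v, FinalSystem r D v) (∀ v, FinalSystem r D v) ℂ,
        IsLOCC C ∧ ∀ ρ : Matrix (Fin D) (Fin D) ℂ,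
          C (stageState hT L M (k + 1) (Nat.succ_pos k) (absorb hT L M k hn
              (measured (splitLast hT L M (k + 1) hn ψ) (m o))) * ρ *
            (stageState hT L M (k + 1) (Nat.succ_pos k) (absorb hT L M k hn
              (measured (splitLast hT L M (k + 1) hn ψ) (m o))))ᴴ) =
          ((t o * c : ℝ) : ℂ) • finalState r ρ := by
      intro o
      set χ := absorb hT L M k hn (measured (splitLast hT L M (k + 1) hn ψ) (m o)) with hχ
      have hχg : ∀ l l', ∑ x, star (χ l x) * χ l' x =
          if l = l' then ((t o * c : ℝ) : ℂ) else 0 := fun l l' =>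
        (sum_absorb hT L M k hn _ l l').trans (hgram o l l')
      -- Nothing is assumed about continuations after outcomes of probability 0, but the protocol
      -- must continue; any LOCC map will do, as both state and weight vanish.
      by_cases h0 : χ = 0
      · obtain ⟨C, hC⟩ := IsLOCC.exists_of_stage (ℓ := fun w => (L.label w : ℕ))
          (X := InitialSystem T M ι) hr hD (n := Fintype.card V)
          (fun k hk => ⟨L.vertex k hk, L.label_vertex k hk⟩)
          (fun v w h => L.label.injective (Fin.ext h)) k (by omega)
        refine ⟨C, hC, fun ρ => ?_⟩
        have h1 : ((t o * c : ℝ) : ℂ) = 0 := by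
          have := hχg ⟨0, hD⟩ ⟨0, hD⟩
          rw [if_pos rfl, h0] at this
          simpa using this.symm
        have h2 : stageState hT L M (k + 1) (Nat.succ_pos k) χ = 0 := by
          rw [h0, ← zero_smul ℂ, stageState_smul, zero_smul]
          exact 0
        rw [h1, h2, Matrix.zero_mul, Matrix.zero_mul, hC.map_zero, zero_smul]
      · have hne : measured (splitLast hT L M (k + 1) hn ψ) (m o) ≠ 0 := by
          intro h
          apply h0
          rw [hχ, h]
          rfl
        set s : ℝ := Real.sqrt (∑ l, ∑ x, ‖χ l x‖ ^ 2) with hs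
        have hs0 : s ≠ 0 := by
          intro h
          apply h0
          have h1 := (Real.sqrt_eq_zero (Finset.sum_nonneg fun l _ =>
            Finset.sum_nonneg fun x _ => by positivity)).1 (hs.symm.trans h)
          funext l x
          have h2 := (Finset.sum_eq_zero_iff_of_nonneg fun l _ =>
            Finset.sum_nonneg fun x _ => by positivity).1 h1 l (Finset.mem_univ l)
          have h3 := (Finset.sum_eq_zero_iff_of_nonneg fun x _ => by positivity).1 h2 x
            (Finset.mem_univ x)
          simpa using h3
        have hsC : (s : ℂ) ≠ 0 := by exact_mod_cast hs0
        have hnorm : χ = (s : ℂ) • normalized χ := by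
          funext l x
          simp only [Pi.smul_apply, smul_eq_mul, normalized, ← hs]
          field_simp
        -- Normalising divides the Gram constant by `s ^ 2`, and homogeneity of `C` restores this
        -- factor afterwards.
        obtain ⟨C, hC, hCρ⟩ := ih (Nat.succ_pos k) (Nat.le_of_succ_le hn) (normalized χ)
          (t o * c / s ^ 2) (div_nonneg (mul_nonneg (ht0 o) hc) (sq_nonneg s)) (by
            intro l l'
            have h1 : ∀ x, star (normalized χ l x) * normalized χ l' x =
                (star (χ l x) * χ l' x) * ((s : ℂ) ^ 2)⁻¹ := by
              intro x
              simp only [normalized, ← hs, star_div₀, Complex.star_def, Complex.conj_ofReal]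
              field_simp
            simp only [h1]
            rw [← Finset.sum_mul, hχg]
            split_ifs
            · push_cast
              rw [div_eq_mul_inv]
            · simp) (hnext o hne)
        refine ⟨C, hC, fun ρ => ?_⟩
        have h2 : stageState hT L M (k + 1) (Nat.succ_pos k) χ =
            (s : ℂ) • stageState hT L M (k + 1) (Nat.succ_pos k) (normalized χ) := by
          conv_lhs => rw [hnorm]
          rw [stageState_smul]
        rw [h2, Matrix.conjTranspose_smul]
        simp only [Matrix.smul_mul, Matrix.mul_smul]
        rw [hC.map_smul, hC.map_smul, hCρ, smul_smul, smul_smul]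
        congr 1
        rw [Complex.star_def, Complex.conj_ofReal]
        push_cast
        field_simp
    choose next hnextL hnextρ using hstep
    obtain ⟨C, hC, hCρ⟩ := IsLOCC.exists_measure (ℓ := fun w => (L.label w : ℕ))
      (X := InitialSystem T M ι) (L.vertex_eq hn) hv (fun o a => m o (splitHalf hT L M k hn a)) (by
        ext a a'
        rw [Matrix.sum_apply]
        by_cases h : a = a'
        · subst h
          rw [Matrix.one_apply_eq]
          exact hm1 _
        · rw [Matrix.one_apply_ne h]
          exact hm0 _ _ fun h' => h ((splitHalf_bijective hT L M k hn).1 h')) next hnextL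
    refine ⟨C, hC, fun ρ => ?_⟩
    rw [hCρ D _ _ ρ fun o y l => stageState_absorb_measured hT L M k hn ψ (m o) y l]
    simp only [hnextρ]
    rw [← Finset.sum_smul, ← Complex.ofReal_sum, hsum]

end Tree
end

/-! ### The initial state and the main theorem -/

theorem sum_referenceState {V : Type} [Fintype V] [DecidableEq V] {T : SimpleGraph V} (hT : T.IsTree) {r : V}
    (L : AscendingLabeling T r) (M : Sym2 V → ℕ) {ι : V → Type} [∀ v, Fintype (ι v)] {D : ℕ}
    {U : Matrix (∀ v, ι v) (Fin D) ℂ} (hU : Uᴴ * U = 1) (l l' : Fin D) :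
    ∑ x, star (referenceState hT L M U l x) * referenceState hT L M U l' x =
      if l = l' then ((1 / D : ℝ) : ℂ) else 0 := by
  have hs : ((1 / Real.sqrt D : ℝ) : ℂ) * ((1 / Real.sqrt D : ℝ) : ℂ) = ((1 / D : ℝ) : ℂ) := by
    rw [← Complex.ofReal_mul, div_mul_div_comm, Real.mul_self_sqrt (Nat.cast_nonneg D), one_mul]
  have h1 : ∑ x, star (referenceState hT L M U l x) * referenceState hT L M U l' x =
      ∑ y, star (((1 / Real.sqrt D : ℝ) : ℂ) * U y l) * (((1 / Real.sqrt D : ℝ) : ℂ) * U y l') :=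
    (joint_fst_bijective hT L M).sum_comp fun y => star (((1 / Real.sqrt D : ℝ) : ℂ) * U y l) *
      (((1 / Real.sqrt D : ℝ) : ℂ) * U y l')
  have h2 : ∑ y, star (U y l) * U y l' = if l = l' then 1 else 0 := by
    have := congrFun (congrFun hU l) l'
    rw [Matrix.mul_apply, Matrix.one_apply] at this
    exact this
  rw [h1]
  trans (((1 / Real.sqrt D : ℝ) : ℂ) * ((1 / Real.sqrt D : ℝ) : ℂ)) * ∑ y, star (U y l) * U y l'
  · rw [Finset.mul_sum]
    refine Finset.sum_congr rfl fun y _ => ?_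
    rw [star_mul', Complex.star_def, Complex.conj_ofReal]
    ring
  · rw [h2, hs]
    split_ifs <;> simp

theorem theorem2 {V : Type} [Fintype V] [DecidableEq V]
    (T : SimpleGraph V) [DecidableRel T.Adj] (hT : T.IsTree) (r : V)
    (ι : V → Type) [∀ v, Fintype (ι v)]
    (D : ℕ) (hD : 0 < D)
    (U : Matrix (∀ v, ι v) (Fin D) ℂ) (hU : Uᴴ * U = 1)
    (M : Sym2 V → ℕ) (hM : ∀ e ∈ T.edgeSet, 0 < M e)
    (hcost : ∃ L : AscendingLabeling T r,
      MergingCostBound hT L M (Fintype.card V) le_rfl (referenceState hT L M U)) :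
    ConcentratingAchievable T r U M := by
  obtain ⟨L, hL⟩ := hcost
  have hN : 0 < Fintype.card V := Fintype.card_pos_iff.2 ⟨r⟩
  obtain ⟨C, hC, hCρ⟩ := exists_isLOCC_of_mergingCostBound hT L hM hD _ hN le_rfl
    (referenceState hT L M U) (1 / D) (by positivity) (sum_referenceState hT L M hU) hL
  have hlt : ∀ w, (L.label w : ℕ) < Fintype.card V := fun w => (L.label w).isLt
  have : ∀ v, DecidableEq (InitialSystem T M ι v) := fun v => Classical.decEq _
  obtain ⟨C', hC', hC'ρ⟩ := IsLOCC.exists_of_full_stage (ℓ := fun w => (L.label w : ℕ))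
    (X := InitialSystem T M ι) r hlt hC
  refine ⟨C', hC', fun ρ _ _ => ?_⟩
  have hDC : (D : ℂ) ≠ 0 := by exact_mod_cast hD.ne'
  have hs : (D : ℂ) * (((1 / Real.sqrt D : ℝ) : ℂ) * ((1 / Real.sqrt D : ℝ) : ℂ)) = 1 := by
    rw [← Complex.ofReal_mul, div_mul_div_comm, Real.mul_self_sqrt (Nat.cast_nonneg D)]
    push_cast
    field_simp
  -- The reference of `Φ^N` is the input index of the matrix, whose columns carry the factor `1 /
  -- √D`. Hence the actual initial state is `D` times the one treated by the protocol, and this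
  -- cancels the Gram constant `1 / D`.
  have hinit : (initialState T M U ρ).submatrix
      (fun (y : ∀ w, InitialStage L M ι (Fintype.card V) w) w => y w (hlt w))
      (fun y w => y w (hlt w)) =
      (D : ℂ) • (stageState hT L M _ hN (referenceState hT L M U) * ρ *
        (stageState hT L M _ hN (referenceState hT L M U))ᴴ) := by
    ext y y'
    have h1 : ∀ (y : ∀ w, InitialStage L M ι (Fintype.card V) w) l,
        stageState hT L M _ hN (referenceState hT L M U) y l =
        ((1 / Real.sqrt D : ℝ) : ℂ) * resourceAmp T M (fun w => y w (hlt w)) *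
          U (fun v => (y v (hlt v)).1) l := by
      intro y l
      rw [resourceAmp_eq_prod_edgeAmp hT L hlt]
      simp only [stageState, referenceState, held, Matrix.of_apply]
      ring
    rw [Matrix.submatrix_apply, initialState, Matrix.smul_apply, smul_eq_mul]
    simp only [Matrix.mul_apply, Matrix.conjTranspose_apply, h1, Finset.sum_mul, Finset.mul_sum,
      star_mul', Complex.star_def, Complex.conj_ofReal]
    refine Finset.sum_congr rfl fun l _ => Finset.sum_congr rfl fun l' _ => ?_
    linear_combination (-(U (fun v => (y v (hlt v)).1) l' * ρ l' l *
      (starRingEnd ℂ) (U (fun v => (y' v (hlt v)).1) l) *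
      (resourceAmp T M (fun w => y w (hlt w)) *
        (starRingEnd ℂ) (resourceAmp T M (fun w => y' w (hlt w)))))) * hs
  rw [hC'ρ, hinit, hC.map_smul, hCρ, smul_smul]
  have h2 : (D : ℂ) * ((1 / D : ℝ) : ℂ) = 1 := by
    push_cast
    field_simp
  rw [h2, one_smul]
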